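/- Let $k$ be a field. A quiver $Q$ is finite and connected (hence nonempty); $kQ$ is its path algebra, $F\subseteq kQ$ the two-sided ideal generated by the arrows, and a two-sided ideal $I$ of $kQ$ is admissible if $F^m\subseteq I\subseteq F^2$ for some $m\ge 2$. A presentation $(Q,I)$ of a $k$-algebra $A$ consists of such a quiver $Q$ and an admissible ideal $I$ of $kQ$ that is the kernel of a surjective $k$-algebra morphism $kQ\to A$. A triangular algebra is a basic, connected, finite dimensional $k$-algebra whose quiver (the quiver of a presentation of it) has no oriented cycles. A minimal relation of $I$ is an element $\sum_{i=1}^m\lambda_i w_i\in I$ with $m\ge 2$, $\lambda_i\in k\setminus\{0\}$ and $w_1,\dots,w_m$ pairwise different paths with the same source and the same target, such that $\sum_{i\in J}\lambda_i w_i\notin I$ for every nonempty proper subset $J\subset\{1,\dots,m\}$. A walk is a composition of arrows and formal inverses of arrows. Homotopy is the smallest equivalence relation $\sim$ on walks (between walks with the same endpoints) such that $\alpha\alpha^{-1}\sim e_x$ and $\alpha^{-1}\alpha\sim e_y$ for each arrow $\alpha:x\to y$; $w_i\sim w_j$ for any two paths occurring in one minimal relation of $I$; and $u\sim v$ implies $wuw'\sim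 wvw'$ whenever the compositions are defined. The fundamental group $\pi_1(Q,I,v)$ is the group of homotopy classes of closed walks at the vertex $v$ under composition. **Theorem.** Let $G_1,\dots,G_n$ be finitely presented groups. Then there exist a triangular $k$-algebra $A$, a finite connected quiver $\hat Q$ without oriented cycles, and ideals $I_1,\dots,I_n$ of $k\hat Q$ such that, for each $i=1,\dots,n$, $(\hat Q,I_i)$ is a presentation of $A$ and $\pi_1(\hat Q,I_i,v)\cong G_i$ for every vertex $v$ of $\hat Q$. -/

import Mathlib

universe u v w

namespace BoundQuiver

open Quiver

section PathAlgebra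

variable (k : Type w) [Field k] (V : Type u) [Quiver.{v} V]

/-- All oriented paths of the quiver, including the stationary path `Path.nil` at each vertex. -/
abbrev AllPaths := Σ x y : V, Path x y

/-- The path algebra `kQ`: the `k`-vector space whose basis is the set of all paths. -/
def PathAlgebra := AllPaths V →₀ k

noncomputable instance : AddCommGroup (PathAlgebra k V) :=
  inferInstanceAs (AddCommGroup (AllPaths V →₀ k))

noncomputable instance : Module k (PathAlgebra k V) :=
  inferInstanceAs (Module k (AllPaths V →₀ k))

/-- The basis of the path algebra given by the paths. -/
noncomputable def pathBasis : Module.Basis (AllPaths V) k (PathAlgebra k V) :=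
  Module.Basis.ofRepr (LinearEquiv.refl k (AllPaths V →₀ k))

variable {V}

/-- A path, as an element of the path algebra. -/
noncomputable def ofPath {x y : V} (p : Path x y) : PathAlgebra k V :=
  pathBasis k V ⟨x, y, p⟩

open Classical in
/-- The product of two paths: their composition if it is defined, and `0` otherwise. -/
noncomputable def pathMul (p q : AllPaths V) : PathAlgebra k V :=
  if h : q.1 = p.2.1 then ofPath k (p.2.2.comp (q.2.2.cast h rfl)) else 0

/-- The bilinear extension of the product of paths. -/
noncomputable def mulHom :
    PathAlgebra k V →ₗ[k] PathAlgebra k V →ₗ[k] PathAlgebra k V :=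
  (pathBasis k V).constr k fun p => (pathBasis k V).constr k fun q => pathMul k p q

noncomputable instance : Mul (PathAlgebra k V) := ⟨fun f g => mulHom k f g⟩

/-- The unit of the path algebra is the sum of all stationary paths. -/
noncomputable instance [Fintype V] : One (PathAlgebra k V) :=
  ⟨∑ x : V, ofPath k (Path.nil : Path x x)⟩

theorem mul_def (f g : PathAlgebra k V) : f * g = mulHom k f g := rfl

theorem one_def [Fintype V] :
    (1 : PathAlgebra k V) = ∑ x : V, ofPath k (Path.nil : Path x x) := rfl

theorem mulHom_ofPath {x y z t : V} (p : Path x y) (q : Path z t) :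
    mulHom k (ofPath k p) (ofPath k q) = pathMul k ⟨x, y, p⟩ ⟨z, t, q⟩ := by
  simp only [mulHom, ofPath, Module.Basis.constr_basis]

theorem ofPath_mul_ofPath {x y z : V} (p : Path x y) (q : Path y z) :
    ofPath k p * ofPath k q = ofPath k (p.comp q) := by
  rw [mul_def, mulHom_ofPath]
  simp [pathMul]

theorem ofPath_mul_ofPath_of_ne {x y z t : V} (p : Path x y) (q : Path z t) (h : z ≠ y) :
    ofPath k p * ofPath k q = 0 := by
  rw [mul_def, mulHom_ofPath]
  simp [pathMul, h]

variable {k} in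
theorem pathAlgebra_induction {P : PathAlgebra k V → Prop} (f : PathAlgebra k V)
    (zero : P 0) (add : ∀ f g, P f → P g → P (f + g))
    (scale : ∀ (c : k) f, P f → P (c • f))
    (path : ∀ {x y : V} (p : Path x y), P (ofPath k p)) : P f := by
  have hf : f ∈ Submodule.span k (Set.range (pathBasis k V)) := by
    rw [(pathBasis k V).span_eq]; trivial
  induction hf using Submodule.span_induction with
  | mem g hg =>
    obtain ⟨⟨x, y, p⟩, rfl⟩ := hg
    exact path p
  | zero => exact zero
  | add f g _ _ hf hg => exact add f g hf hg
  | smul c f _ hf => exact scale c f hf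

theorem pathAlgebra_mul_assoc (f g h : PathAlgebra k V) : f * g * h = f * (g * h) := by
  simp only [mul_def]
  induction f using pathAlgebra_induction with
  | zero => simp only [map_zero, LinearMap.zero_apply]
  | add f₁ f₂ h₁ h₂ => simp only [map_add, LinearMap.add_apply, h₁, h₂]
  | scale c f₁ h₁ => simp only [map_smul, LinearMap.smul_apply, h₁]
  | @path x y p =>
  induction g using pathAlgebra_induction with
  | zero => simp only [map_zero, LinearMap.zero_apply]
  | add f₁ f₂ h₁ h₂ => simp only [map_add, LinearMap.add_apply, h₁, h₂]
  | scale c f₁ h₁ => simp only [map_smul, LinearMap.smul_apply, h₁]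
  | @path x' y' q =>
  induction h using pathAlgebra_induction with
  | zero => simp only [map_zero]
  | add f₁ f₂ h₁ h₂ => simp only [map_add, h₁, h₂]
  | scale c f₁ h₁ => simp only [map_smul, h₁]
  | @path x'' y'' r =>
  simp only [← mul_def]
  by_cases h₁ : x' = y
  · subst h₁
    rw [ofPath_mul_ofPath]
    by_cases h₂ : x'' = y'
    · subst h₂
      simp only [ofPath_mul_ofPath, Path.comp_assoc]
    · rw [ofPath_mul_ofPath_of_ne k _ r h₂, ofPath_mul_ofPath_of_ne k _ r h₂]
      simp [mul_def]
  · rw [ofPath_mul_ofPath_of_ne k p q h₁]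
    by_cases h₂ : x'' = y'
    · subst h₂
      rw [ofPath_mul_ofPath, ofPath_mul_ofPath_of_ne k p _ h₁]
      simp [mul_def]
    · rw [ofPath_mul_ofPath_of_ne k q r h₂]
      simp [mul_def]

theorem pathAlgebra_one_mul [Fintype V] (f : PathAlgebra k V) : 1 * f = f := by
  simp only [mul_def, one_def]
  induction f using pathAlgebra_induction with
  | zero => simp
  | add f₁ f₂ h₁ h₂ => rw [map_add, h₁, h₂]
  | scale c f₁ h₁ => simp only [map_smul, h₁]
  | @path x y p =>
  rw [map_sum, LinearMap.sum_apply, Finset.sum_eq_single x]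
  · rw [← mul_def, ofPath_mul_ofPath, Path.nil_comp]
  · intro b _ hb
    rw [← mul_def, ofPath_mul_ofPath_of_ne k _ _ hb.symm]
  · simp

theorem pathAlgebra_mul_one [Fintype V] (f : PathAlgebra k V) : f * 1 = f := by
  simp only [mul_def, one_def]
  induction f using pathAlgebra_induction with
  | zero => simp
  | add f₁ f₂ h₁ h₂ => rw [map_add, LinearMap.add_apply, h₁, h₂]
  | scale c f₁ h₁ => simp only [map_smul, LinearMap.smul_apply, h₁]
  | @path x y p =>
  rw [map_sum, Finset.sum_eq_single y]
  · rw [← mul_def, ofPath_mul_ofPath, Path.comp_nil]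
  · intro b _ hb
    rw [← mul_def, ofPath_mul_ofPath_of_ne k _ _ hb]
  · simp

noncomputable instance [Fintype V] : Ring (PathAlgebra k V) :=
  { (inferInstance : AddCommGroup (PathAlgebra k V)),
    (inferInstance : Mul (PathAlgebra k V)),
    (inferInstance : One (PathAlgebra k V)) with
    left_distrib := fun a b c => by simp only [mul_def, map_add]
    right_distrib := fun a b c => by simp only [mul_def, map_add, LinearMap.add_apply]
    zero_mul := fun a => by simp only [mul_def, map_zero, LinearMap.zero_apply]
    mul_zero := fun a => by simp only [mul_def, map_zero]
    mul_assoc := pathAlgebra_mul_assoc k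
    one_mul := pathAlgebra_one_mul k
    mul_one := pathAlgebra_mul_one k }

noncomputable instance [Fintype V] : Algebra k (PathAlgebra k V) :=
  Algebra.ofModule
    (fun r x y => by simp only [mul_def, map_smul, LinearMap.smul_apply])
    (fun r x y => by simp only [mul_def, map_smul])

end PathAlgebra

section Homotopy

variable {k : Type w} [Field k] {V : Type u} [Quiver.{v} V] [Fintype V]

/-- Walks: `fwd α w` is the walk `α w` and `bwd α w` is the walk `α⁻¹ w`, where `α` is an arrow
and `α⁻¹` its formal inverse. -/
inductive Walk {V : Type u} [Quiver.{v} V] : V → V → Type (max u v)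
  | nil {x : V} : Walk x x
  | fwd {x y z : V} (α : x ⟶ y) (w : Walk y z) : Walk x z
  | bwd {x y z : V} (α : y ⟶ x) (w : Walk y z) : Walk x z

namespace Walk

variable {V : Type u} [Quiver.{v} V]

/-- Composition of walks. -/
def comp {x y z : V} : Walk x y → Walk y z → Walk x z
  | nil, w' => w'
  | fwd α w, w' => fwd α (comp w w')
  | bwd α w, w' => bwd α (comp w w')

/-- The inverse walk. -/
def reverse {x y : V} : Walk x y → Walk y x
  | nil => nil
  | fwd α w => (reverse w).comp (bwd α nil)
  | bwd α w => (reverse w).comp (fwd α nil)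

/-- An oriented path, seen as a walk. -/
def ofPath {x y : V} : Path x y → Walk x y
  | Path.nil => nil
  | Path.cons p α => (ofPath p).comp (fwd α nil)

theorem nil_comp {x y : V} (w : Walk x y) : nil.comp w = w := rfl

theorem comp_nil {x y : V} (w : Walk x y) : w.comp nil = w := by
  induction w with
  | nil => rfl
  | fwd α w ih => simp only [comp, ih]
  | bwd α w ih => simp only [comp, ih]

theorem comp_assoc {x y z t : V} (a : Walk x y) (b : Walk y z) (c : Walk z t) :
    (a.comp b).comp c = a.comp (b.comp c) := by
  induction a with
  | nil => rfl
  | fwd α w ih => simp only [comp, ih]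
  | bwd α w ih => simp only [comp, ih]

end Walk

/-- `ρ = ∑ λ_p p` (with `p` running over the finitely many parallel paths in its support, where
`λ_p ≠ 0`) is a minimal relation of `I`: it lies in `I`, has at least two terms, and no partial
sum over a nonempty proper subset of its terms lies in `I`. -/
structure IsMinimalRelation (I : Ideal (PathAlgebra k V)) {x y : V} (ρ : Path x y →₀ k) :
    Prop where
  mem : ∑ p ∈ ρ.support, ρ p • ofPath k p ∈ I
  two_le : 2 ≤ ρ.support.card
  minimal : ∀ J : Finset (Path x y), J ⊂ ρ.support → J.Nonempty →
    ∑ p ∈ J, ρ p • ofPath k p ∉ I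

/-- The smallest equivalence relation on walks that contains `α α⁻¹ ∼ e_x`, `α⁻¹ α ∼ e_y` for
each arrow `α : x ⟶ y`, identifies the paths occurring in one minimal relation, and is compatible
with composition of walks. -/
inductive Homotopic (I : Ideal (PathAlgebra k V)) : ∀ {x y : V}, Walk x y → Walk x y → Prop
  | refl {x y : V} (u : Walk x y) : Homotopic I u u
  | symm {x y : V} {u u' : Walk x y} : Homotopic I u u' → Homotopic I u' u
  | trans {x y : V} {u u' u'' : Walk x y} :
      Homotopic I u u' → Homotopic I u' u'' → Homotopic I u u''
  | arrow_inv {x y : V} (α : x ⟶ y) : Homotopic I (Walk.fwd α (Walk.bwd α Walk.nil)) Walk.nil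
  | inv_arrow {x y : V} (α : x ⟶ y) : Homotopic I (Walk.bwd α (Walk.fwd α Walk.nil)) Walk.nil
  | relation {x y : V} {ρ : Path x y →₀ k} (hρ : IsMinimalRelation I ρ) {p q : Path x y}
      (hp : p ∈ ρ.support) (hq : q ∈ ρ.support) : Homotopic I (Walk.ofPath p) (Walk.ofPath q)
  | comp {x y z t : V} (w : Walk x y) {u u' : Walk y z} (w' : Walk z t) :
      Homotopic I u u' → Homotopic I ((w.comp u).comp w') ((w.comp u').comp w')

/-- Homotopy of closed walks at `x₀`. -/
def homotopySetoid (I : Ideal (PathAlgebra k V)) (x₀ : V) : Setoid (Walk x₀ x₀) where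
  r := Homotopic I
  iseqv := ⟨Homotopic.refl, Homotopic.symm, Homotopic.trans⟩

/-- The fundamental group `π₁(Q, I, x₀)`: closed walks at `x₀` modulo homotopy. -/
def FundamentalGroup (I : Ideal (PathAlgebra k V)) (x₀ : V) := Quotient (homotopySetoid I x₀)

namespace Homotopic

variable {I : Ideal (PathAlgebra k V)}

theorem comp_congr {x y z : V} {u u' : Walk x y} {w w' : Walk y z}
    (h : Homotopic I u u') (h' : Homotopic I w w') : Homotopic I (u.comp w) (u'.comp w') := by
  have h₁ := Homotopic.comp (Walk.nil : Walk x x) w h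
  have h₂ := Homotopic.comp u' (Walk.nil : Walk z z) h'
  simp only [Walk.nil_comp, Walk.comp_nil] at h₁ h₂
  exact h₁.trans h₂

theorem comp_reverse {x y : V} (u : Walk x y) : Homotopic I (u.comp u.reverse) Walk.nil := by
  induction u with
  | nil => exact Homotopic.refl _
  | fwd α w ih =>
    have h := Homotopic.comp (Walk.fwd α Walk.nil) (Walk.bwd α Walk.nil) ih
    simp only [Walk.comp, Walk.comp_assoc] at h
    exact h.trans (Homotopic.arrow_inv α)
  | bwd α w ih =>
    have h := Homotopic.comp (Walk.bwd α Walk.nil) (Walk.fwd α Walk.nil) ih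
    simp only [Walk.comp, Walk.comp_assoc] at h
    exact h.trans (Homotopic.inv_arrow α)

theorem reverse_comp {x y : V} (u : Walk x y) : Homotopic I (u.reverse.comp u) Walk.nil := by
  induction u with
  | nil => exact Homotopic.refl _
  | fwd α w ih =>
    have h := Homotopic.comp w.reverse w (Homotopic.inv_arrow (I := I) α)
    simp only [Walk.comp, Walk.comp_nil, Walk.comp_assoc] at h
    simp only [Walk.reverse, Walk.comp, Walk.comp_assoc]
    exact h.trans ih
  | bwd α w ih =>
    have h := Homotopic.comp w.reverse w (Homotopic.arrow_inv (I := I) α)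
    simp only [Walk.comp, Walk.comp_nil, Walk.comp_assoc] at h
    simp only [Walk.reverse, Walk.comp, Walk.comp_assoc]
    exact h.trans ih

theorem reverse_congr {x y : V} {u u' : Walk x y} (h : Homotopic I u u') :
    Homotopic I u.reverse u'.reverse := by
  have h₁ := (comp_congr (Homotopic.refl u.reverse) (comp_reverse (I := I) u')).symm
  have h₂ := Homotopic.comp u.reverse u'.reverse h
  have h₃ := comp_congr (reverse_comp (I := I) u) (Homotopic.refl u'.reverse)
  rw [Walk.comp_nil, ← Walk.comp_assoc] at h₁
  rw [Walk.nil_comp] at h₃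
  exact h₁.trans (h₂.symm.trans h₃)

end Homotopic

/-- The product is induced by the composition of walks. -/
instance (I : Ideal (PathAlgebra k V)) (x₀ : V) : Group (FundamentalGroup I x₀) where
  mul := Quotient.map₂ (fun u w => u.comp w) fun _ _ h _ _ h' => Homotopic.comp_congr h h'
  one := Quotient.mk _ Walk.nil
  inv := Quotient.map (fun u => u.reverse) fun _ _ h => Homotopic.reverse_congr h
  mul_assoc := by
    rintro ⟨a⟩ ⟨b⟩ ⟨c⟩
    exact congrArg (Quotient.mk _) (Walk.comp_assoc a b c)
  one_mul := by
    rintro ⟨a⟩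
    exact congrArg (Quotient.mk _) (Walk.nil_comp a)
  mul_one := by
    rintro ⟨a⟩
    exact congrArg (Quotient.mk _) (Walk.comp_nil a)
  inv_mul_cancel := by
    rintro ⟨a⟩
    exact Quotient.sound (Homotopic.reverse_comp a)

end Homotopy

section Presentations

/-- The quiver is finite and connected (as an undirected graph; in particular nonempty). -/
structure IsFiniteConnected (V : Type u) [Quiver.{v} V] : Prop where
  finite_vertices : Finite V
  finite_arrows : ∀ x y : V, Finite (x ⟶ y)
  nonempty : Nonempty V
  connected : ∀ x y : V, Nonempty (Walk x y)

/-- The quiver has no oriented cycles. -/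
def IsAcyclic (V : Type u) [Quiver.{v} V] : Prop :=
  ∀ (x : V) (p : Path x x), p.length = 0

variable (k : Type w) [Field k] (V : Type u) [Quiver.{v} V] [Fintype V]

/-- The two-sided ideal of the path algebra generated by the arrows. -/
noncomputable def arrowIdeal : Ideal (PathAlgebra k V) :=
  (TwoSidedIdeal.span
    {a : PathAlgebra k V | ∃ (x y : V) (α : x ⟶ y), a = ofPath k α.toPath}).asIdeal

variable {k V}

/-- `I` is an admissible (two-sided) ideal: `F ^ m ⊆ I ⊆ F ^ 2` for some `m ≥ 2`. -/
structure IsAdmissible (I : Ideal (PathAlgebra k V)) : Prop where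
  isTwoSided : I.IsTwoSided
  exists_pow_le : ∃ m : ℕ, 2 ≤ m ∧ arrowIdeal k V ^ m ≤ I
  le_sq : I ≤ arrowIdeal k V ^ 2

/-- `(Q, I)` is a presentation of the `k`-algebra `A`: the quiver is finite and connected, `I` is
admissible, and `I` is the kernel of a surjective algebra morphism `kQ → A`. -/
structure IsPresentation (A : Type w) [Ring A] [Algebra k A] (I : Ideal (PathAlgebra k V)) :
    Prop where
  isFiniteConnected : IsFiniteConnected V
  isAdmissible : IsAdmissible I
  exists_hom : ∃ ν : PathAlgebra k V →ₐ[k] A, Function.Surjective ν ∧ RingHom.ker ν = I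

/-- `A` is basic: modulo its radical it is a finite product of division rings. -/
def IsBasic (A : Type w) [Ring A] : Prop :=
  ∃ (m : ℕ) (D : Fin m → Type w) (_ : ∀ i, DivisionRing (D i)),
    Nonempty ((A ⧸ Ring.jacobson A) ≃+* (∀ i, D i))

/-- `A` is connected: it is nonzero and has no central idempotents except `0` and `1`. -/
def IsConnectedAlgebra (A : Type w) [Ring A] : Prop :=
  Nontrivial A ∧ ∀ e : A, IsIdempotentElem e → (∀ a : A, e * a = a * e) → e = 0 ∨ e = 1

variable (k) in
/-- A triangular algebra: a basic, connected, finite dimensional algebra whose quiver (that is,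
the quiver of a presentation of it) has no oriented cycles. -/
structure IsTriangularAlgebra (A : Type w) [Ring A] [Algebra k A] : Prop where
  finite : Module.Finite k A
  isBasic : IsBasic A
  isConnected : IsConnectedAlgebra A
  exists_presentation : ∃ (V : Type) (_ : Quiver.{0} V) (_ : Fintype V)
    (I : Ideal (PathAlgebra k V)), IsAcyclic V ∧ IsPresentation A I

end Presentations

end BoundQuiver

/-! Let `H` be the product of the groups `G i`, and let `σ` list without repetition a finite subset
of `H` with `σ o = 1`. The quiver has three vertices in a row and two consecutive families of
arrows, both indexed by `X`. The arrow with index `a` is labelled in `k[H]` by `σ a` in the first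
family and by `σ a + ε a · 1` in the second, where `ε o = 0`. Labels multiply along paths, which
represents the path algebra by matrices over `k[H]`; `relationIdeal σ ε` is the kernel.

The algebra does not depend on `ε`: the base arrow `snd o` has label `1`, so changing `ε` only adds
multiples of this label to the others, and the image stays the same (`range_labelRep_eq`). The
kernels for different `ε` are therefore presentations of one algebra.

The homotopy relation does depend on `ε`. If `σ s * σ t = σ u` and `t ≠ o`, then `path s t - path u
o - ε t • path s o` is a minimal relation (`homotopic_path`). It makes the classes of the arrows
multiply as `σ` does, and if `ε t ≠ 0` it also kills the class of `t`. For the `i`-th presentation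
`ε` is nonzero exactly at the non-base indices whose `i`-th coordinate is `1`, so all other factors
are killed.

No further collapse occurs: the labels are homogeneous for the projection `H → G i`, hence so are
all minimal relations (`degree_eq_of_isMinimalRelation`), and the degree is a morphism from the
fundamental group to `G i`. Its inverse comes from finite presentability: `exists_finset_extension`
gives a finite generating set of `G i` such that a map defined on it and respecting the products
that stay inside extends to a morphism. The values of `σ` are `1` and these sets, embedded in the
factors. -/

namespace BoundQuiver

open Quiver

/-! ### Path algebras: filtration by length and augmentation -/

section PathAlgebraTheory

variable {k : Type w} [Field k] {V : Type u} [Quiver.{v} V]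

section Lift

variable [Fintype V] {B : Type*} [Ring B] [Algebra k B]

/-- The algebra morphism out of the path algebra determined by its values on paths. -/
noncomputable def liftPaths (F : AllPaths V → B)
    (h_one : ∑ x : V, F ⟨x, x, Path.nil⟩ = 1)
    (h_mul : ∀ {x y z : V} (p : Path x y) (q : Path y z),
      F ⟨x, y, p⟩ * F ⟨y, z, q⟩ = F ⟨x, z, p.comp q⟩)
    (h_ne : ∀ {x y z t : V} (p : Path x y) (q : Path z t), z ≠ y →
      F ⟨x, y, p⟩ * F ⟨z, t, q⟩ = 0) : PathAlgebra k V →ₐ[k] B :=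
  AlgHom.ofLinearMap ((pathBasis k V).constr k F)
    (by
      rw [one_def, map_sum, ← h_one]
      exact Finset.sum_congr rfl fun x _ => (pathBasis k V).constr_basis k F ⟨x, x, Path.nil⟩)
    (by
      have key (p : AllPaths V) : (pathBasis k V).constr k F (ofPath k p.2.2) = F p :=
        (pathBasis k V).constr_basis k F p
      intro f g
      induction f using pathAlgebra_induction with
      | zero => simp
      | add f₁ f₂ h₁ h₂ => rw [add_mul, map_add, map_add, add_mul, h₁, h₂]
      | scale c f₁ h₁ => rw [smul_mul_assoc, map_smul, map_smul, smul_mul_assoc, h₁]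
      | @path x y p =>
      induction g using pathAlgebra_induction with
      | zero => simp
      | add f₁ f₂ h₁ h₂ => rw [mul_add, map_add, map_add, mul_add, h₁, h₂]
      | scale c f₁ h₁ => rw [mul_smul_comm, map_smul, map_smul, mul_smul_comm, h₁]
      | @path z t q =>
      rw [key ⟨x, y, p⟩, key ⟨z, t, q⟩]
      by_cases h : z = y
      · subst h
        rw [ofPath_mul_ofPath, key ⟨x, t, p.comp q⟩, h_mul]
      · rw [ofPath_mul_ofPath_of_ne k p q h, map_zero, h_ne p q h])

theorem liftPaths_ofPath (F : AllPaths V → B) (h_one h_mul h_ne) {x y : V} (p : Path x y) :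
    liftPaths (k := k) F h_one h_mul h_ne (ofPath k p) = F ⟨x, y, p⟩ :=
  (pathBasis k V).constr_basis k F ⟨x, y, p⟩

end Lift

variable (k V) in
/-- The span of the paths of length at least `m`. -/
noncomputable def longPaths (m : ℕ) : Submodule k (PathAlgebra k V) :=
  Submodule.span k (pathBasis k V '' {p | m ≤ p.2.2.length})

theorem ofPath_mem_longPaths {m : ℕ} {x y : V} {p : Path x y} (h : m ≤ p.length) :
    ofPath k p ∈ longPaths k V m :=
  Submodule.subset_span ⟨⟨x, y, p⟩, h, rfl⟩

theorem mem_longPaths_iff {m : ℕ} {f : PathAlgebra k V} :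
    f ∈ longPaths k V m ↔
      ∀ p : AllPaths V, (pathBasis k V).repr f p ≠ 0 → m ≤ p.2.2.length := by
  rw [longPaths, Module.Basis.mem_span_image]
  simp [Set.subset_def]

theorem ofPath_mem_longPaths_iff {m : ℕ} {x y : V} {p : Path x y} :
    ofPath k p ∈ longPaths k V m ↔ m ≤ p.length := by
  refine ⟨fun h => ?_, ofPath_mem_longPaths⟩
  refine mem_longPaths_iff.1 h ⟨x, y, p⟩ ?_
  rw [ofPath, Module.Basis.repr_self]
  simp

theorem longPaths_zero : longPaths k V 0 = ⊤ := by
  rw [eq_top_iff]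
  intro f _
  exact mem_longPaths_iff.2 fun _ _ => Nat.zero_le _

variable [Fintype V]

theorem mul_mem_longPaths {m n : ℕ} {f g : PathAlgebra k V} (hf : f ∈ longPaths k V m)
    (hg : g ∈ longPaths k V n) : f * g ∈ longPaths k V (m + n) := by
  have h := Submodule.mul_mem_mul hf hg
  rw [longPaths, longPaths, Submodule.span_mul_span] at h
  refine Submodule.span_le.2 ?_ h
  rintro _ ⟨_, ⟨⟨x, y, p⟩, hp, rfl⟩, _, ⟨⟨z, t, q⟩, hq, rfl⟩, rfl⟩
  change ofPath k p * ofPath k q ∈ longPaths k V (m + n)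
  by_cases h : z = y
  · subst h
    rw [ofPath_mul_ofPath]
    exact ofPath_mem_longPaths (by rw [Path.length_comp]; exact add_le_add hp hq)
  · rw [ofPath_mul_ofPath_of_ne k p q h]
    exact zero_mem _

theorem smul_mem_ideal (I : Ideal (PathAlgebra k V)) (c : k) {f : PathAlgebra k V} (hf : f ∈ I) :
    c • f ∈ I := by
  rw [← one_mul f, ← smul_mul_assoc]
  exact I.mul_mem_left _ hf

theorem ofPath_toPath_mem_arrowIdeal {x y : V} (α : x ⟶ y) :
    ofPath k α.toPath ∈ arrowIdeal k V :=
  TwoSidedIdeal.mem_asIdeal.2 (TwoSidedIdeal.subset_span ⟨x, y, α, rfl⟩)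

theorem arrowIdeal_le {f : PathAlgebra k V} (hf : f ∈ arrowIdeal k V) : f ∈ longPaths k V 1 := by
  rw [arrowIdeal, TwoSidedIdeal.mem_asIdeal] at hf
  induction hf using TwoSidedIdeal.span_induction with
  | mem f hf =>
    obtain ⟨x, y, α, rfl⟩ := hf
    exact ofPath_mem_longPaths (by simp)
  | zero => exact zero_mem _
  | add f g _ _ hf hg => exact add_mem hf hg
  | neg f _ hf => exact neg_mem hf
  | left_absorb a f _ hf =>
    simpa using mul_mem_longPaths (m := 0) (f := a) (by simp [longPaths_zero]) hf
  | right_absorb a f _ hf =>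
    simpa using mul_mem_longPaths (n := 0) (g := a) hf (by simp [longPaths_zero])

theorem ofPath_mem_arrowIdeal_pow (m : ℕ) {x y : V} (p : Path x y) (h : m ≤ p.length) :
    ofPath k p ∈ arrowIdeal k V ^ m := by
  induction m generalizing y with
  | zero => simp [Submodule.pow_zero]
  | succ m ih =>
    cases p with
    | nil => simp at h
    | cons q α =>
      have := Ideal.mul_mem_mul (ih q (by simpa using h)) (ofPath_toPath_mem_arrowIdeal (k := k) α)
      rwa [ofPath_mul_ofPath, ← Submodule.pow_succ] at this

/-- Turns admissibility into a condition on the lengths of the paths in the support. -/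
theorem mem_arrowIdeal_pow {m : ℕ} {f : PathAlgebra k V} :
    f ∈ arrowIdeal k V ^ m ↔ f ∈ longPaths k V m := by
  constructor
  · induction m generalizing f with
    | zero => simp [longPaths_zero]
    | succ m ih =>
      rw [Submodule.pow_succ]
      intro hf
      refine Submodule.smul_induction_on hf (fun a ha b hb => ?_) fun _ _ => add_mem
      exact mul_mem_longPaths (ih ha) (arrowIdeal_le hb)
  · intro hf
    induction hf using Submodule.span_induction with
    | mem f hf =>
      obtain ⟨p, hp, rfl⟩ := hf
      exact ofPath_mem_arrowIdeal_pow m p.2.2 hp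
    | zero => exact zero_mem _
    | add f g _ _ hf hg => exact add_mem hf hg
    | smul c f _ hf => exact smul_mem_ideal _ c hf

variable (k V) in
open Classical in
/-- The coefficients of the stationary paths. -/
noncomputable def augmentation : PathAlgebra k V →ₐ[k] (V → k) :=
  liftPaths (fun p => if p.2.2.length = 0 then Pi.single p.1 1 else 0)
    (by
      funext x
      simp)
    (by
      intro x y z p q
      by_cases hp : p.length = 0
      · obtain rfl := Path.eq_of_length_zero p hp
        by_cases hq : q.length = 0 <;> simp [hp, hq, ← Pi.single_mul]
      · simp [hp])
    (by
      intro x y z t p q h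
      by_cases hp : p.length = 0
      · obtain rfl := Path.eq_of_length_zero p hp
        by_cases hq : q.length = 0
        · funext a
          by_cases ha : a = x <;> simp [hp, hq, ha, Pi.single_apply, h.symm]
        · simp [hq]
      · simp [hp])

theorem augmentation_nil (x : V) [DecidableEq V] :
    augmentation k V (ofPath k (Path.nil : Path x x)) = Pi.single x 1 := by
  rw [augmentation, liftPaths_ofPath]
  simp only [Path.length_nil, if_true]
  convert rfl

theorem augmentation_of_length_ne_zero {x y : V} (p : Path x y) (h : p.length ≠ 0) :
    augmentation k V (ofPath k p) = 0 := by
  rw [augmentation, liftPaths_ofPath]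
  simp [h]

/-- The combination of stationary paths with given coefficients. -/
noncomputable def stationary (c : V → k) : PathAlgebra k V :=
  ∑ x, c x • ofPath k (Path.nil : Path x x)

theorem augmentation_stationary (c : V → k) : augmentation k V (stationary c) = c := by
  classical
  funext y
  simp [stationary, augmentation_nil, Pi.single_apply]

theorem sub_stationary_mem (f : PathAlgebra k V) :
    f - stationary (augmentation k V f) ∈ longPaths k V 1 := by
  classical
  induction f using pathAlgebra_induction with
  | zero => simp [stationary]
  | add f g hf hg =>
    convert add_mem hf hg using 1
    simp only [stationary, map_add, Pi.add_apply, add_smul, Finset.sum_add_distrib]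
    abel
  | scale c f hf =>
    convert Submodule.smul_mem _ c hf using 1
    simp only [stationary, map_smul, Pi.smul_apply, smul_assoc, smul_sub, Finset.smul_sum]
  | @path x y p =>
    by_cases hp : p.length = 0
    · obtain rfl := Path.eq_of_length_zero p hp
      obtain rfl := Path.eq_nil_of_length_zero p hp
      rw [augmentation_nil, stationary, Finset.sum_eq_single x] <;> simp +contextual
    · rw [augmentation_of_length_ne_zero p hp]
      simpa [stationary] using ofPath_mem_longPaths (k := k) (Nat.one_le_iff_ne_zero.2 hp)

theorem augmentation_eq_zero_iff {f : PathAlgebra k V} :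
    augmentation k V f = 0 ↔ f ∈ longPaths k V 1 := by
  constructor
  · intro h
    simpa [h, stationary] using sub_stationary_mem f
  · intro hf
    induction hf using Submodule.span_induction with
    | mem f hf =>
      obtain ⟨p, hp, rfl⟩ := hf
      exact augmentation_of_length_ne_zero p.2.2 (Nat.one_le_iff_ne_zero.1 hp)
    | zero => exact map_zero _
    | add f g _ _ hf hg => rw [map_add, hf, hg, add_zero]
    | smul c f _ hf => rw [map_smul, hf, smul_zero]

theorem stationary_mul_ofPath (c : V → k) {x y : V} (p : Path x y) :
    stationary c * ofPath k p = c x • ofPath k p := by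
  classical
  rw [stationary, Finset.sum_mul, Finset.sum_eq_single x]
  · rw [smul_mul_assoc, ofPath_mul_ofPath, Path.nil_comp]
  · intro b _ hb
    rw [smul_mul_assoc, ofPath_mul_ofPath_of_ne k _ _ hb.symm, smul_zero]
  · simp

theorem ofPath_mul_stationary (c : V → k) {x y : V} (p : Path x y) :
    ofPath k p * stationary c = c y • ofPath k p := by
  classical
  rw [stationary, Finset.mul_sum, Finset.sum_eq_single y]
  · rw [mul_smul_comm, ofPath_mul_ofPath, Path.comp_nil]
  · intro b _ hb
    rw [mul_smul_comm, ofPath_mul_ofPath_of_ne k _ _ hb, smul_zero]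
  · simp

/-- Modulo paths of length at least two only the stationary part of `f` contributes to the
commutator with `α`, and it gives the multiple of `α` by the difference of the two coefficients. -/
theorem augmentation_eq_of_commutator_mem {f : PathAlgebra k V} {x y : V} (α : x ⟶ y)
    (h : f * ofPath k α.toPath - ofPath k α.toPath * f ∈ longPaths k V 2) :
    augmentation k V f x = augmentation k V f y := by
  have hr := sub_stationary_mem f
  have hα : ofPath k α.toPath ∈ longPaths k V 1 := ofPath_mem_longPaths (by simp)
  have h₁ : (f - stationary (augmentation k V f)) * ofPath k α.toPath ∈ longPaths k V (1 + 1) :=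
    mul_mem_longPaths hr hα
  have h₂ : ofPath k α.toPath * (f - stationary (augmentation k V f)) ∈ longPaths k V (1 + 1) :=
    mul_mem_longPaths hα hr
  rw [one_add_one_eq_two] at h₁ h₂
  have h₃ := Submodule.sub_mem _ h (Submodule.sub_mem _ h₁ h₂)
  have h₄ : f * ofPath k α.toPath - ofPath k α.toPath * f -
      ((f - stationary (augmentation k V f)) * ofPath k α.toPath -
        ofPath k α.toPath * (f - stationary (augmentation k V f))) =
      (augmentation k V f x - augmentation k V f y) • ofPath k α.toPath := by
    rw [sub_mul, mul_sub, stationary_mul_ofPath, ofPath_mul_stationary, sub_sub_sub_comm,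
      sub_sub_cancel, sub_sub_cancel, ← sub_smul]
  rw [h₄] at h₃
  by_contra hne
  rw [Submodule.smul_mem_iff _ (sub_ne_zero.2 hne), ofPath_mem_longPaths_iff] at h₃
  rw [Path.length_toPath] at h₃
  exact absurd h₃ (by decide)

end PathAlgebraTheory

/-! ### Algebras with a presentation are basic and connected -/

section PresentedAlgebra

variable {k : Type w} [Field k] {V : Type u} [Quiver.{v} V] [Fintype V]
  {A : Type w} [Ring A] [Algebra k A] {I : Ideal (PathAlgebra k V)}

theorem IsAdmissible.augmentation_eq_zero (hI : IsAdmissible I) {f : PathAlgebra k V}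
    (hf : f ∈ I) : augmentation k V f = 0 := by
  rw [augmentation_eq_zero_iff]
  exact arrowIdeal_le (Ideal.pow_le_self two_ne_zero (hI.le_sq hf))

/-- The augmentation of an algebra with a presentation. -/
theorem IsPresentation.exists_augmentation (h : IsPresentation A I) :
    ∃ (ν : PathAlgebra k V →ₐ[k] A) (φ : A →+* (V → k)), Function.Surjective ν ∧
      RingHom.ker ν = I ∧ (∀ f, φ (ν f) = augmentation k V f) ∧ Function.Surjective φ ∧
      ∀ a, φ a = 0 → IsNilpotent a := by
  obtain ⟨ν, hν, hker⟩ := h.exists_hom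
  have hle : RingHom.ker (ν : PathAlgebra k V →+* A) ≤
      RingHom.ker (augmentation k V : PathAlgebra k V →+* (V → k)) := fun f hf =>
    h.isAdmissible.augmentation_eq_zero (hker ▸ hf)
  let φ := RingHom.liftOfSurjective (ν : PathAlgebra k V →+* A) hν
    ⟨(augmentation k V : PathAlgebra k V →+* (V → k)), hle⟩
  have hφ (f) : φ (ν f) = augmentation k V f :=
    RingHom.liftOfRightInverse_comp_apply (ν : PathAlgebra k V →+* A) _ _
      ⟨(augmentation k V : PathAlgebra k V →+* (V → k)), hle⟩ f
  refine ⟨ν, φ, hν, hker, hφ, fun c => ⟨ν (stationary c), ?_⟩, fun a ha => ?_⟩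
  · rw [hφ, augmentation_stationary]
  · obtain ⟨f, rfl⟩ := hν a
    rw [hφ, augmentation_eq_zero_iff] at ha
    obtain ⟨m, -, hm⟩ := h.isAdmissible.exists_pow_le
    refine ⟨m, ?_⟩
    rw [← map_pow]
    have : f ^ m ∈ I := hm (Ideal.pow_mem_pow (by
      have := (mem_arrowIdeal_pow (m := 1)).2 ha
      rwa [Submodule.pow_one] at this) m)
    rw [← hker] at this
    exact this

/-- The radical is the kernel of the augmentation: the target is a finite product of fields, so its
radical vanishes, and all elements of the kernel are nilpotent. -/
theorem IsPresentation.isBasic (h : IsPresentation A I) : IsBasic A := by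
  obtain ⟨-, φ, -, -, -, hφ, hnil⟩ := h.exists_augmentation
  have hJ : Ring.jacobson A = RingHom.ker φ := by
    apply le_antisymm
    · have : RingHomSurjective φ := ⟨hφ⟩
      have h₁ := Ring.le_comap_jacobson φ
      have h₂ : Ring.jacobson (V → k) = ⊥ := by
        rw [eq_bot_iff]
        intro c hc
        rw [← Ideal.jacobson_bot, Ideal.mem_jacobson_bot] at hc
        rw [Ideal.mem_bot]
        by_contra hne
        obtain ⟨x, hx⟩ := Function.ne_iff.1 hne
        -- For this multiplier the element that should be a unit has value `0` at the coordinate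
        -- `x`.
        have := (hc (fun y => -(c y)⁻¹)).map (Pi.evalRingHom (fun _ : V => k) x)
        simp [mul_inv_cancel₀ (show c x ≠ 0 from hx)] at this
      rwa [h₂] at h₁
    · intro a ha
      rw [← Ideal.jacobson_bot, Ideal.mem_jacobson_iff]
      intro b
      have hn : IsNilpotent (b * a) := hnil _ (by
        rw [map_mul, show φ a = 0 from ha, mul_zero])
      obtain ⟨u, hu⟩ := hn.isUnit_one_add
      refine ⟨(↑u⁻¹ : A), ?_⟩
      have : (↑u⁻¹ : A) * (1 + b * a) = 1 := by rw [← hu, Units.inv_mul]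
      rw [Ideal.mem_bot, ← sub_eq_zero.2 this]
      noncomm_ring
  have e : (A ⧸ Ring.jacobson A) ≃+* (V → k) := by
    have key (J : Ideal A) [J.IsTwoSided] (hJ : J = RingHom.ker φ) :
        Nonempty ((A ⧸ J) ≃+* (V → k)) := by
      subst hJ
      exact ⟨RingHom.quotientKerEquivOfSurjective hφ⟩
    exact (key _ hJ).some
  exact ⟨Fintype.card V, fun _ => k, fun _ => inferInstance,
    ⟨e.trans (RingEquiv.piCongrLeft (fun _ => k) (Fintype.equivFin V))⟩⟩

/-- Lift a central idempotent to `f`. Its commutators with arrows lie in `I`, hence in the square of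
the arrow ideal, so the augmentation of `f` is constant along walks. The constant is idempotent in
`k`, and an idempotent killed by the augmentation is nilpotent, hence zero. -/
theorem IsPresentation.isConnectedAlgebra (h : IsPresentation A I) : IsConnectedAlgebra A := by
  obtain ⟨ν, φ, hν, hker, hφν, hφ, hnil⟩ := h.exists_augmentation
  obtain ⟨x₀⟩ := h.isFiniteConnected.nonempty
  have : Nonempty V := ⟨x₀⟩
  have idem_zero (e : A) (he : IsIdempotentElem e) (h0 : φ e = 0) : e = 0 := by
    obtain ⟨m, hm⟩ := hnil e h0
    rcases m with _ | m
    · rw [pow_zero] at hm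
      rw [← one_mul e, hm, zero_mul]
    · rwa [he.pow_succ_eq] at hm
  refine ⟨φ.domain_nontrivial, fun e he hcomm => ?_⟩
  obtain ⟨f, rfl⟩ := hν e
  have arrow {x y : V} (α : x ⟶ y) : augmentation k V f x = augmentation k V f y := by
    refine augmentation_eq_of_commutator_mem α (mem_arrowIdeal_pow.1 ?_)
    apply h.isAdmissible.le_sq
    rw [← hker, RingHom.mem_ker, map_sub, map_mul, map_mul, hcomm, sub_self]
  have walk {x y : V} (w : Walk x y) : augmentation k V f x = augmentation k V f y := by
    induction w with
    | nil => rfl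
    | fwd α w ih => exact (arrow α).trans ih
    | bwd α w ih => exact (arrow α).symm.trans ih
  have hc (x : V) : augmentation k V f x = augmentation k V f x₀ :=
    walk (h.isFiniteConnected.connected x x₀).some
  have hi : augmentation k V f x₀ * augmentation k V f x₀ = augmentation k V f x₀ := by
    rw [← hφν]
    exact congrFun ((map_mul φ _ _).symm.trans (congrArg φ he)) x₀
  rcases IsIdempotentElem.iff_eq_zero_or_one.1 hi with h0 | h1
  · left
    apply idem_zero _ he
    rw [hφν]
    funext x
    rw [hc, h0, Pi.zero_apply]
  · right
    refine (sub_eq_zero.1 (idem_zero _ he.one_sub ?_)).symm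
    rw [map_sub, hφν, map_one]
    funext x
    rw [Pi.sub_apply, hc, h1, Pi.one_apply, sub_self, Pi.zero_apply]

end PresentedAlgebra

end BoundQuiver

/-! ### Finitely presented groups and partial multiplication tables -/

/-- Take for `S` a ball for the word length that contains all prefixes and suffixes of the relators.
A map respecting products inside `S` can be evaluated on a relator letter by letter, so it sends
every relator to `1`. -/
theorem Group.IsFinitelyPresented.exists_finset_extension (G : Type u) [Group G]
    [Group.IsFinitelyPresented G] :
    ∃ S : Finset G, Subgroup.closure (S : Set G) = ⊤ ∧
      ∀ (K : Type v) [Group K] (f : G → K),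
        (∀ s ∈ S, ∀ t ∈ S, s * t ∈ S → f (s * t) = f s * f t) →
        ∃ F : G →* K, ∀ s ∈ S, F s = f s := by
  classical
  obtain ⟨n, φ, hφ, R, hR, hker⟩ := Group.IsFinitelyPresented.out (G := G)
  obtain ⟨N, hN⟩ : ∃ N, ∀ r ∈ R, r.toWord.length ≤ N := by
    obtain ⟨N, hN⟩ := (hR.image fun r => r.toWord.length).bddAbove
    exact ⟨N, fun r hr => hN ⟨r, hr, rfl⟩⟩
  -- The `+ 1` ensures that single letters belong to the ball even when `N = 0`.
  have hfin : ((fun L => φ (FreeGroup.mk L)) ''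
      {L : List (Fin n × Bool) | L.length ≤ N + 1}).Finite :=
    (List.finite_length_le _ _).image _
  have hmem (L : List (Fin n × Bool)) (hL : L.length ≤ N + 1) :
      φ (FreeGroup.mk L) ∈ hfin.toFinset := hfin.mem_toFinset.2 ⟨L, hL, rfl⟩
  have h_one : (1 : G) ∈ hfin.toFinset := by
    have := hmem [] (by simp)
    rwa [← FreeGroup.one_eq_mk, map_one] at this
  refine ⟨hfin.toFinset, ?_, fun K _ f hf => ?_⟩
  · rw [eq_top_iff]
    rintro g -
    obtain ⟨r, rfl⟩ := hφ g
    induction r using FreeGroup.induction_on with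
    | C1 => rw [map_one]; exact one_mem _
    | of i => exact Subgroup.subset_closure (hmem [(i, true)] (by simp))
    | inv_of i hi => rw [map_inv]; exact inv_mem hi
    | mul x y hx hy => rw [map_mul]; exact mul_mem hx hy
  · have f_one : f 1 = 1 := by
      have := hf 1 h_one 1 h_one (by rwa [mul_one])
      rwa [mul_one, left_eq_mul] at this
    let F₀ : FreeGroup (Fin n) →* K := FreeGroup.lift fun i => f (φ (FreeGroup.of i))
    have F₀_letter (a : Fin n × Bool) : F₀ (FreeGroup.mk [a]) = f (φ (FreeGroup.mk [a])) := by
      obtain ⟨i, b⟩ := a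
      have h_of : F₀ (FreeGroup.of i) = f (φ (FreeGroup.of i)) := FreeGroup.lift_apply_of
      cases b with
      | true => exact h_of
      | false =>
        have h_inv : (FreeGroup.mk [(i, false)] : FreeGroup (Fin n)) = (FreeGroup.of i)⁻¹ := rfl
        have h₁ := hf _ (hmem [(i, true)] (by simp)) _ (hmem [(i, false)] (by simp))
        rw [h_inv] at h₁ ⊢
        change φ (FreeGroup.of i) * φ (FreeGroup.of i)⁻¹ ∈ _ →
          f (φ (FreeGroup.of i) * φ (FreeGroup.of i)⁻¹) =
            f (φ (FreeGroup.of i)) * f (φ (FreeGroup.of i)⁻¹) at h₁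
        rw [← map_mul, mul_inv_cancel, map_one, f_one] at h₁
        rw [map_inv F₀, h_of]
        exact inv_eq_of_mul_eq_one_right (h₁ h_one).symm
    have F₀_word (L : List (Fin n × Bool)) (hL : L.length ≤ N + 1) :
        F₀ (FreeGroup.mk L) = f (φ (FreeGroup.mk L)) := by
      induction L with
      | nil => rw [← FreeGroup.one_eq_mk, map_one, map_one, f_one]
      | cons a L ih =>
        have h_mk : (FreeGroup.mk (a :: L) : FreeGroup (Fin n)) =
            FreeGroup.mk [a] * FreeGroup.mk L := by
          rw [FreeGroup.mul_mk, List.singleton_append]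
        have hL' : L.length ≤ N + 1 := by
          rw [List.length_cons] at hL
          exact (Nat.le_succ _).trans hL
        have h := hmem _ hL
        rw [h_mk, map_mul] at h
        rw [h_mk, map_mul, map_mul, hf _ (hmem [a] (by simp)) _ (hmem L hL') h, F₀_letter,
          ih hL']
    have hle : φ.ker ≤ F₀.ker := by
      rw [← hker]
      refine Subgroup.normalClosure_le_normal fun r hr => ?_
      have hrφ : φ r = 1 := by
        rw [← MonoidHom.mem_ker, ← hker]
        exact Subgroup.subset_normalClosure hr
      have := F₀_word r.toWord ((hN r hr).trans (Nat.le_succ _))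
      rw [FreeGroup.mk_toWord, hrφ, f_one] at this
      exact this
    refine ⟨φ.liftOfSurjective hφ ⟨F₀, hle⟩, fun s hs => ?_⟩
    obtain ⟨L, hL, rfl⟩ := hfin.mem_toFinset.1 hs
    exact (MonoidHom.liftOfRightInverse_comp_apply _ _ _ _ _).trans (F₀_word L hL)

namespace BoundQuiver

open Quiver

/-! ### Fundamental groups from gradings of the arrows -/

section FundamentalGroup

variable {k : Type w} [Field k] {V : Type u} [Quiver.{v} V] [Fintype V]
  {G : Type*} [Group G]

namespace Walk

/-- The degree of a walk, for a family of degrees of the arrows. -/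
def degree {V : Type u} [Quiver.{v} V] (d : ∀ {x y : V}, (x ⟶ y) → G) :
    ∀ {x y : V}, Walk x y → G
  | _, _, nil => 1
  | _, _, fwd α w => d α * degree d w
  | _, _, bwd α w => (d α)⁻¹ * degree d w

theorem degree_comp {V : Type u} [Quiver.{v} V] (d : ∀ {x y : V}, (x ⟶ y) → G) {x y z : V}
    (w : Walk x y) (w' : Walk y z) : degree d (w.comp w') = degree d w * degree d w' := by
  induction w with
  | nil => exact (one_mul _).symm
  | fwd α w ih => simp only [comp, degree, ih, mul_assoc]
  | bwd α w ih => simp only [comp, degree, ih, mul_assoc]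

end Walk

variable {I : Ideal (PathAlgebra k V)} (d : ∀ {x y : V}, (x ⟶ y) → G)

theorem Homotopic.degree_eq
    (hd : ∀ {x y : V} (ρ : Path x y →₀ k), IsMinimalRelation I ρ → ∀ p ∈ ρ.support,
      ∀ q ∈ ρ.support, Walk.degree d (Walk.ofPath p) = Walk.degree d (Walk.ofPath q))
    {x y : V} {w w' : Walk x y} (h : Homotopic I w w') : Walk.degree d w = Walk.degree d w' := by
  induction h with
  | refl => rfl
  | symm _ ih => exact ih.symm
  | trans _ _ ih₁ ih₂ => exact ih₁.trans ih₂
  | arrow_inv α => simp [Walk.degree]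
  | inv_arrow α => simp [Walk.degree]
  | relation hρ hp hq => exact hd _ hρ _ hp _ hq
  | comp w w' _ ih => simp only [Walk.degree_comp, ih]

variable {x₀ : V} (τ : ∀ x : V, Walk x₀ x)

variable (I) in
/-- The class of the closed walk obtained by connecting the ends of a walk to the base point. -/
def walkClass {x y : V} (w : Walk x y) : FundamentalGroup I x₀ :=
  Quotient.mk (homotopySetoid I x₀) ((τ x).comp (w.comp (τ y).reverse))

theorem walkClass_eq_of_homotopic {x y : V} {w w' : Walk x y} (h : Homotopic I w w') :
    walkClass I τ w = walkClass I τ w' :=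
  Quotient.sound (s := homotopySetoid I x₀)
    (Homotopic.comp_congr (Homotopic.refl _) (Homotopic.comp_congr h (Homotopic.refl _)))

theorem walkClass_comp {x y z : V} (w : Walk x y) (w' : Walk y z) :
    walkClass I τ (w.comp w') = walkClass I τ w * walkClass I τ w' := by
  refine Quotient.sound (s := homotopySetoid I x₀) ?_
  change Homotopic I _ (((τ x).comp (w.comp (τ y).reverse)).comp
    ((τ y).comp (w'.comp (τ z).reverse)))
  have := Homotopic.comp ((τ x).comp w) (w'.comp (τ z).reverse)
    (Homotopic.reverse_comp (I := I) (τ y))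
  simp only [Walk.comp_assoc, Walk.nil_comp] at this ⊢
  exact this.symm

theorem walkClass_nil {x : V} : walkClass I τ (Walk.nil : Walk x x) = 1 :=
  Quotient.sound (s := homotopySetoid I x₀) (Homotopic.comp_reverse (τ x))

theorem walkClass_bwd {x y : V} (α : x ⟶ y) :
    walkClass I τ (Walk.bwd α Walk.nil) = (walkClass I τ (Walk.fwd α Walk.nil))⁻¹ := by
  rw [eq_inv_iff_mul_eq_one, ← walkClass_comp, ← walkClass_nil (I := I) τ (x := y)]
  exact walkClass_eq_of_homotopic τ (Homotopic.inv_arrow α)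

theorem walkClass_closed (hτ : Homotopic I (τ x₀) Walk.nil) (w : Walk x₀ x₀) :
    walkClass I τ w = Quotient.mk (homotopySetoid I x₀) w := by
  refine Quotient.sound (s := homotopySetoid I x₀) ?_
  change Homotopic I ((τ x₀).comp (w.comp (τ x₀).reverse)) w
  have := Homotopic.comp_congr hτ
    (Homotopic.comp_congr (Homotopic.refl w) (Homotopic.reverse_congr hτ))
  simpa only [Walk.reverse, Walk.comp_nil, Walk.nil_comp] using this

/-- A grading of the arrows by a group `G` that is compatible with the minimal relations, and
whose degrees determine the classes of the arrows, identifies the fundamental group with `G`. -/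
theorem nonempty_fundamentalGroup_mulEquiv
    (hd : ∀ {x y : V} (ρ : Path x y →₀ k), IsMinimalRelation I ρ → ∀ p ∈ ρ.support,
      ∀ q ∈ ρ.support, Walk.degree d (Walk.ofPath p) = Walk.degree d (Walk.ofPath q))
    (hτ : Homotopic I (τ x₀) Walk.nil) (hτd : ∀ x, Walk.degree d (τ x) = 1)
    (F : G →* FundamentalGroup I x₀)
    (hF : ∀ {x y : V} (α : x ⟶ y), walkClass I τ (Walk.fwd α Walk.nil) = F (d α))
    (hgen : Subgroup.closure {g | ∃ (x y : V) (α : x ⟶ y), d α = g} = ⊤) :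
    Nonempty (FundamentalGroup I x₀ ≃* G) := by
  let D : FundamentalGroup I x₀ →* G :=
    { toFun := Quotient.lift (Walk.degree d) fun _ _ h => Homotopic.degree_eq d hd h
      map_one' := rfl
      map_mul' := by
        rintro ⟨a⟩ ⟨b⟩
        exact Walk.degree_comp d a b }
  have hFw {x y : V} (w : Walk x y) : walkClass I τ w = F (Walk.degree d w) := by
    induction w with
    | nil => rw [walkClass_nil, Walk.degree, map_one]
    | fwd α w ih =>
      rw [Walk.degree, map_mul, ← hF, ← ih, ← walkClass_comp]
      rfl
    | bwd α w ih =>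
      rw [Walk.degree, map_mul, map_inv, ← hF, ← ih, ← walkClass_bwd, ← walkClass_comp]
      rfl
  have hDr {x : V} (w : Walk x₀ x) : Walk.degree d w.reverse = (Walk.degree d w)⁻¹ := by
    rw [eq_inv_iff_mul_eq_one, ← Walk.degree_comp]
    exact Homotopic.degree_eq d hd (Homotopic.reverse_comp w)
  -- It suffices to check degrees of arrows: the connecting walks have degree `1`, so closing up an
  -- arrow does not change its degree.
  have hDF : D.comp F = MonoidHom.id G := by
    refine MonoidHom.eq_of_eqOn_dense hgen ?_
    rintro _ ⟨x, y, α, rfl⟩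
    rw [MonoidHom.comp_apply, ← hF]
    change Walk.degree d ((τ x).comp ((Walk.fwd α Walk.nil).comp (τ y).reverse)) = d α
    simp [Walk.degree_comp, hDr, hτd, Walk.degree]
  refine ⟨MulEquiv.ofBijective D ⟨?_, fun g => ⟨F g, DFunLike.congr_fun hDF g⟩⟩⟩
  -- By `hFw` the class of a closed walk is recovered from its degree through `F`.
  apply Function.LeftInverse.injective (g := F)
  rintro ⟨w⟩
  exact (hFw w).symm.trans (walkClass_closed τ hτ w)

end FundamentalGroup

/-! ### Matrix representations from labels in an algebra -/

section LabelRepresentation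

variable {k : Type w} [Field k] {V : Type u} [Quiver.{v} V] {R : Type*} [Ring R] [Algebra k R]

/-- The product of the labels of the arrows of a path. -/
def pathLabel (l : ∀ {x y : V}, (x ⟶ y) → R) {x : V} : ∀ {y : V}, Path x y → R
  | _, Path.nil => 1
  | _, Path.cons p α => pathLabel l p * l α

theorem pathLabel_comp (l : ∀ {x y : V}, (x ⟶ y) → R) {x y z : V} (p : Path x y)
    (q : Path y z) : pathLabel l (p.comp q) = pathLabel l p * pathLabel l q := by
  induction q with
  | nil => exact (mul_one _).symm
  | cons q α ih => rw [Path.comp_cons, pathLabel, pathLabel, ih, mul_assoc]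

theorem pathLabel_toPath (l : ∀ {x y : V}, (x ⟶ y) → R) {x y : V} (α : x ⟶ y) :
    pathLabel l α.toPath = l α := one_mul _

variable [Fintype V] [DecidableEq V]

variable (k) in
/-- The representation of the path algebra by matrices given by a labelling of the arrows. -/
noncomputable def labelRep (l : ∀ {x y : V}, (x ⟶ y) → R) :
    PathAlgebra k V →ₐ[k] Matrix V V R :=
  liftPaths (fun p => Matrix.single p.1 p.2.1 (pathLabel l p.2.2))
    (by
      simp only [pathLabel]
      ext x y
      rw [Matrix.sum_apply]
      by_cases h : x = y
      · subst h
        simp [Matrix.single_apply]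
      · rw [Matrix.one_apply_ne h]
        exact Finset.sum_eq_zero fun z _ =>
          Matrix.single_apply_of_ne _ _ _ _ _ fun hz => h (hz.1.symm.trans hz.2))
    (fun p q => by rw [pathLabel_comp, Matrix.single_mul_single_same])
    (fun p q h => Matrix.single_mul_single_of_ne _ _ _ _ h.symm _)

theorem labelRep_ofPath (l : ∀ {x y : V}, (x ⟶ y) → R) {x y : V}
    (p : Path x y) : labelRep k l (ofPath k p) = Matrix.single x y (pathLabel l p) :=
  liftPaths_ofPath _ _ _ _ p

/-- Parallel paths share one matrix entry, so relations between them are linear relations between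
their labels. -/
theorem sum_mem_ker_labelRep_iff (l : ∀ {x y : V}, (x ⟶ y) → R) {x y : V}
    (J : Finset (Path x y)) (c : Path x y → k) :
    ∑ p ∈ J, c p • ofPath k p ∈ RingHom.ker (labelRep k l) ↔
      ∑ p ∈ J, c p • pathLabel l p = 0 := by
  classical
  have h : labelRep k l (∑ p ∈ J, c p • ofPath k p) =
      Matrix.single x y (∑ p ∈ J, c p • pathLabel l p) := by
    rw [map_sum, ← Matrix.singleAddMonoidHom_apply, map_sum]
    refine Finset.sum_congr rfl fun p _ => ?_
    rw [map_smul, labelRep_ofPath, Matrix.smul_single, Matrix.singleAddMonoidHom_apply]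
  rw [RingHom.mem_ker, h]
  refine ⟨fun h0 => ?_, fun h0 => by rw [h0, Matrix.single_zero]⟩
  have := congrFun (congrFun h0 x) y
  rwa [Matrix.single_apply_same] at this

theorem range_labelRep_le (l : ∀ {x y : V}, (x ⟶ y) → R) (S : Subalgebra k (Matrix V V R))
    (h_nil : ∀ x : V, labelRep k l (ofPath k (Path.nil : Path x x)) ∈ S)
    (h_arrow : ∀ {x y : V} (α : x ⟶ y), labelRep k l (ofPath k α.toPath) ∈ S) :
    (labelRep k l).range ≤ S := by
  rintro _ ⟨f, rfl⟩
  change labelRep k l f ∈ S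
  induction f using pathAlgebra_induction with
  | zero => rw [map_zero]; exact zero_mem _
  | add f g hf hg => rw [map_add]; exact add_mem hf hg
  | scale c f hf => rw [map_smul]; exact S.smul_mem hf c
  | @path x y p =>
    induction p with
    | nil => exact h_nil x
    | cons p α ih =>
      have h : ofPath k (p.cons α) = ofPath k p * ofPath k α.toPath := by
        rw [ofPath_mul_ofPath]
        rfl
      rw [h, map_mul]
      exact mul_mem ih (h_arrow α)

/-- Minimal relations are homogeneous for every grading of the arrows for which the labels are
homogeneous. -/
theorem degree_eq_of_isMinimalRelation {H G : Type*} [Group H] [Group G] (π : H →* G)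
    (d : ∀ {x y : V}, (x ⟶ y) → G) (l : ∀ {x y : V}, (x ⟶ y) → MonoidAlgebra k H)
    (hl : ∀ {x y : V} (α : x ⟶ y) (h : H), (l α).coeff h ≠ 0 → π h = d α)
    {x y : V} (ρ : Path x y →₀ k) (hρ : IsMinimalRelation (RingHom.ker (labelRep k l)) ρ)
    (p : Path x y) (hp : p ∈ ρ.support) (q : Path x y) (hq : q ∈ ρ.support) :
    Walk.degree d (Walk.ofPath p) = Walk.degree d (Walk.ofPath q) := by
  classical
  have hpath {x y : V} (p : Path x y) (h : H) (hh : (pathLabel l p).coeff h ≠ 0) :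
      π h = Walk.degree d (Walk.ofPath p) := by
    induction p generalizing h with
    | nil =>
      rw [pathLabel, MonoidAlgebra.one_def, MonoidAlgebra.coeff_single, Finsupp.single_apply] at hh
      obtain rfl : 1 = h := by
        by_contra hne
        exact hh (if_neg hne)
      exact map_one π
    | cons p α ih =>
      rw [pathLabel] at hh
      have hmem := MonoidAlgebra.support_coeff_mul_subset _ _ (Finsupp.mem_support_iff.2 hh)
      obtain ⟨a, ha, b, hb, rfl⟩ := Finset.mem_mul.1 hmem
      rw [Walk.ofPath, Walk.degree_comp, map_mul, ih a (Finsupp.mem_support_iff.1 ha),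
        hl α b (Finsupp.mem_support_iff.1 hb)]
      simp [Walk.degree]
  -- The terms of the degree of `p` already form a relation: a group element of that degree gets
  -- contributions only from `J`, any other gets none from `J`. Minimality forces `J` to be the
  -- whole support.
  set J := ρ.support.filter fun p' =>
    Walk.degree d (Walk.ofPath p') = Walk.degree d (Walk.ofPath p) with hJ
  have hsum : ∑ p' ∈ J, ρ p' • pathLabel l p' = 0 := by
    have htotal := (sum_mem_ker_labelRep_iff l _ _).1 hρ.mem
    apply MonoidAlgebra.coeff_injective
    ext h
    have htotal_h : ∑ p' ∈ ρ.support, ρ p' * (pathLabel l p').coeff h = 0 := by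
      have := DFunLike.congr_fun (congrArg MonoidAlgebra.coeff htotal) h
      simpa [MonoidAlgebra.coeff_sum, Finsupp.finsetSum_apply] using this
    have goal_h : ∑ p' ∈ J, ρ p' * (pathLabel l p').coeff h = 0 := by
      by_cases hh : π h = Walk.degree d (Walk.ofPath p)
      · rw [← htotal_h]
        refine Finset.sum_subset (Finset.filter_subset _ _) fun p' hp' hp'J => ?_
        by_contra hne
        refine hp'J (Finset.mem_filter.2 ⟨hp', ?_⟩)
        rw [← hh, hpath p' h (right_ne_zero_of_mul hne)]
      · refine Finset.sum_eq_zero fun p' hp' => ?_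
        by_contra hne
        apply hh
        rw [hpath p' h (right_ne_zero_of_mul hne)]
        exact (Finset.mem_filter.1 hp').2
    simpa [MonoidAlgebra.coeff_sum, Finsupp.finsetSum_apply] using goal_h
  by_contra hne
  refine hρ.minimal J ⟨Finset.filter_subset _ _, fun hsub => ?_⟩
    ⟨p, Finset.mem_filter.2 ⟨hp, rfl⟩⟩ ((sum_mem_ker_labelRep_iff l _ _).2 hsum)
  exact hne (Finset.mem_filter.1 (hsub hq)).2.symm

end LabelRepresentation

/-! ### The three-vertex quiver -/

/-- The vertices of the quiver with two consecutive families of arrows indexed by `X`. -/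
inductive Layered (X : Type) : Type
  | src : Layered X
  | mid : Layered X
  | snk : Layered X

namespace Layered

/-- The arrows of the quiver with two consecutive families of arrows indexed by `X`. -/
inductive Hom {X : Type} : Layered X → Layered X → Type
  | fst (a : X) : Hom src mid
  | snd (a : X) : Hom mid snk

variable {X : Type}

instance : Quiver.{0} (Layered X) := ⟨Hom⟩

noncomputable instance : DecidableEq (Layered X) := Classical.decEq _

noncomputable instance : Fintype (Layered X) :=
  Fintype.ofList [src, mid, snk] (by rintro ⟨⟩ <;> simp)

/-- The arrow with index `a` of the first family. -/
abbrev fst (a : X) : (src : Layered X) ⟶ mid := Hom.fst a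

/-- The arrow with index `a` of the second family. -/
abbrev snd (a : X) : (mid : Layered X) ⟶ snk := Hom.snd a

/-- The path of length two with indices `a` and `b`. -/
abbrev path (a b : X) : Path (src : Layered X) snk := (fst a).toPath.cons (snd b)

theorem allPaths_cases (p : AllPaths (Layered X)) :
    (∃ x, p = ⟨x, x, Path.nil⟩) ∨ (∃ a, p = ⟨src, mid, (fst a).toPath⟩) ∨
      (∃ a, p = ⟨mid, snk, (snd a).toPath⟩) ∨ ∃ a b, p = ⟨src, snk, path a b⟩ := by
  obtain ⟨x, y, p⟩ := p
  cases p with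
  | nil => exact Or.inl ⟨x, rfl⟩
  | cons p α =>
    rcases α with a | b
    · cases p with
      | nil => exact Or.inr (Or.inl ⟨a, rfl⟩)
      | cons p β => rcases β
    · cases p with
      | nil => exact Or.inr (Or.inr (Or.inl ⟨b, rfl⟩))
      | cons p β =>
        rcases β with ⟨a⟩
        cases p with
        | nil => exact Or.inr (Or.inr (Or.inr ⟨a, b, rfl⟩))
        | cons p γ => rcases γ

theorem isAcyclic : IsAcyclic (Layered X) := by
  intro x p
  rcases allPaths_cases ⟨x, x, p⟩ with ⟨y, h⟩ | ⟨a, h⟩ | ⟨a, h⟩ | ⟨a, b, h⟩ <;> cases h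
  rfl

theorem length_le_two {x y : Layered X} (p : Path x y) : p.length ≤ 2 := by
  rcases allPaths_cases ⟨x, y, p⟩ with ⟨y, h⟩ | ⟨a, h⟩ | ⟨a, h⟩ | ⟨a, b, h⟩ <;> cases h <;>
    simp

instance [Finite X] : Finite (AllPaths (Layered X)) := by
  let f : Layered X ⊕ X ⊕ X ⊕ X × X → AllPaths (Layered X)
    | Sum.inl x => ⟨x, x, Path.nil⟩
    | Sum.inr (Sum.inl a) => ⟨src, mid, (fst a).toPath⟩
    | Sum.inr (Sum.inr (Sum.inl a)) => ⟨mid, snk, (snd a).toPath⟩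
    | Sum.inr (Sum.inr (Sum.inr (a, b))) => ⟨src, snk, path a b⟩
  refine Finite.of_surjective f fun p => ?_
  rcases allPaths_cases p with ⟨x, rfl⟩ | ⟨a, rfl⟩ | ⟨a, rfl⟩ | ⟨a, b, rfl⟩
  · exact ⟨Sum.inl x, rfl⟩
  · exact ⟨Sum.inr (Sum.inl a), rfl⟩
  · exact ⟨Sum.inr (Sum.inr (Sum.inl a)), rfl⟩
  · exact ⟨Sum.inr (Sum.inr (Sum.inr (a, b))), rfl⟩

/-- The walk from the source along the arrows with index `o`. -/
def baseWalk (o : X) : ∀ x : Layered X, Walk src x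
  | src => Walk.nil
  | mid => Walk.fwd (fst o) Walk.nil
  | snk => Walk.fwd (fst o) (Walk.fwd (snd o) Walk.nil)

theorem isFiniteConnected [Finite X] (o : X) : IsFiniteConnected (Layered X) where
  finite_vertices := inferInstance
  finite_arrows x y := by
    refine Finite.of_injective
      (fun α : x ⟶ y => (⟨x, y, α.toPath⟩ : AllPaths (Layered X))) fun α β h => ?_
    rcases α <;> rcases β <;> cases h <;> rfl
  nonempty := ⟨src⟩
  connected x y := ⟨(baseWalk o x).reverse.comp (baseWalk o y)⟩

/-! ### Twisted labels and the entries of their representation -/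

section Labels

variable {k : Type w} [Field k] {H : Type*} [Group H] (σ : X → H) (ε : X → k)

/-- The labelling of the arrows by `σ`, with the labels of the second family translated by `ε`. -/
noncomputable def label : ∀ {x y : Layered X}, (x ⟶ y) → MonoidAlgebra k H
  | _, _, Hom.fst a => MonoidAlgebra.single (σ a) 1
  | _, _, Hom.snd a => MonoidAlgebra.single (σ a) 1 + MonoidAlgebra.single 1 (ε a)

/-- The ideal of the path algebra of the relations between the labels. -/
noncomputable abbrev relationIdeal : Ideal (PathAlgebra k (Layered X)) :=
  RingHom.ker (labelRep k (label σ ε))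

theorem pathLabel_path (a b : X) : pathLabel (label σ ε) (path a b) =
    MonoidAlgebra.single (σ a * σ b) 1 + MonoidAlgebra.single (σ a) (ε b) := by
  change 1 * MonoidAlgebra.single (σ a) 1 *
    (MonoidAlgebra.single (σ b) 1 + MonoidAlgebra.single 1 (ε b)) = _
  rw [one_mul, mul_add, MonoidAlgebra.single_mul_single, MonoidAlgebra.single_mul_single, one_mul,
    mul_one, one_mul]

variable {σ ε} {o : X}

/-- Linear independence by triangularity: for `a ≠ o` the group element `σ a ≠ 1` occurs in the
`a`-th label only; after that only the label `1` of `o` remains. -/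
theorem coeff_eq_zero_of_sum_eq_zero [Fintype X] (hσ : Function.Injective σ) (ho : σ o = 1)
    (hε : ε o = 0) (c : X → k) (h : ∑ a, c a •
      (MonoidAlgebra.single (σ a) 1 + MonoidAlgebra.single 1 (ε a) : MonoidAlgebra k H) = 0)
    (a : X) : c a = 0 := by
  classical
  have key (g : H) : ∑ a, c a * ((if σ a = g then 1 else 0) + if 1 = g then ε a else 0) = 0 := by
    have := DFunLike.congr_fun (congrArg MonoidAlgebra.coeff h) g
    rw [MonoidAlgebra.coeff_sum, Finsupp.finsetSum_apply] at this
    refine Eq.trans (Finset.sum_congr rfl fun a _ => ?_) this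
    by_cases h₁ : σ a = g <;> by_cases h₂ : 1 = g <;> simp [h₁, h₂, mul_add]
  have hne (a : X) (ha : a ≠ o) : c a = 0 := by
    have h1 : (1 : H) ≠ σ a := fun h => ha (hσ (h.symm.trans ho.symm))
    simpa [h1, hσ.eq_iff] using key (σ a)
  by_cases ha : a = o
  · subst ha
    have := key 1
    rw [Finset.sum_eq_single a (fun b _ hb => by rw [hne b hb, zero_mul]) (by simp)] at this
    simpa [ho, hε] using this
  · exact hne a ha

theorem labelRep_apply_same (f : PathAlgebra k (Layered X)) (x : Layered X) :
    labelRep k (label σ ε) f x x =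
      algebraMap k _ ((pathBasis k (Layered X)).repr f ⟨x, x, Path.nil⟩) := by
  induction f using pathAlgebra_induction with
  | zero => simp
  | add f g hf hg => rw [map_add, map_add, Matrix.add_apply, hf, hg, Finsupp.add_apply, map_add]
  | scale c f hf =>
    rw [map_smul, map_smul, Matrix.smul_apply, hf, Finsupp.smul_apply, smul_eq_mul, map_mul,
      Algebra.smul_def]
  | @path y z p =>
    rw [labelRep_ofPath, ofPath, Module.Basis.repr_self]
    rcases allPaths_cases ⟨y, z, p⟩ with ⟨y, h⟩ | ⟨a, h⟩ | ⟨a, h⟩ | ⟨a, b, h⟩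
    · cases h
      by_cases hx : y = x
      · subst hx
        rw [Matrix.single_apply_same, Finsupp.single_eq_same, map_one]
        rfl
      · rw [Matrix.single_apply_of_ne _ _ _ _ _ fun h => hx h.1, Finsupp.single_eq_of_ne,
          map_zero]
        intro h
        cases h
        exact hx rfl
    all_goals
      cases h
      cases x <;> simp

theorem labelRep_apply_src_mid [Fintype X] (f : PathAlgebra k (Layered X)) :
    labelRep k (label σ ε) f src mid = ∑ a,
      (pathBasis k (Layered X)).repr f ⟨src, mid, (fst a).toPath⟩ • label σ ε (fst a) := by
  induction f using pathAlgebra_induction with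
  | zero => simp
  | add f g hf hg => simp only [map_add, Matrix.add_apply, hf, hg, Finsupp.add_apply, add_smul,
      Finset.sum_add_distrib]
  | scale c f hf => simp only [map_smul, Matrix.smul_apply, hf, Finsupp.smul_apply, smul_assoc,
      Finset.smul_sum]
  | @path x y p =>
    rw [labelRep_ofPath, ofPath, Module.Basis.repr_self]
    rcases allPaths_cases ⟨x, y, p⟩ with ⟨y, h⟩ | ⟨a, h⟩ | ⟨a, h⟩ | ⟨a, b, h⟩ <;> cases h
    · cases x <;> simp
    · rw [Matrix.single_apply_same, Finset.sum_eq_single a]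
      · rw [pathLabel_toPath, Finsupp.single_eq_same, one_smul]
      · intro b _ hb
        rw [Finsupp.single_eq_of_ne, zero_smul]
        intro h
        cases h
        exact hb rfl
      · simp
    · simp
    · simp

theorem labelRep_apply_mid_snk [Fintype X] (f : PathAlgebra k (Layered X)) :
    labelRep k (label σ ε) f mid snk = ∑ a,
      (pathBasis k (Layered X)).repr f ⟨mid, snk, (snd a).toPath⟩ • label σ ε (snd a) := by
  induction f using pathAlgebra_induction with
  | zero => simp
  | add f g hf hg => simp only [map_add, Matrix.add_apply, hf, hg, Finsupp.add_apply, add_smul,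
      Finset.sum_add_distrib]
  | scale c f hf => simp only [map_smul, Matrix.smul_apply, hf, Finsupp.smul_apply, smul_assoc,
      Finset.smul_sum]
  | @path x y p =>
    rw [labelRep_ofPath, ofPath, Module.Basis.repr_self]
    rcases allPaths_cases ⟨x, y, p⟩ with ⟨y, h⟩ | ⟨a, h⟩ | ⟨a, h⟩ | ⟨a, b, h⟩ <;> cases h
    · cases x <;> simp
    · simp
    · rw [Matrix.single_apply_same, Finset.sum_eq_single a]
      · rw [pathLabel_toPath, Finsupp.single_eq_same, one_smul]
      · intro b _ hb
        rw [Finsupp.single_eq_of_ne, zero_smul]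
        intro h
        cases h
        exact hb rfl
      · simp
    · simp

end Labels

end Layered

/-! ### One algebra, many presentations -/

namespace Layered

variable {X : Type} {k : Type w} [Field k] {H : Type*} [Group H] {σ : X → H} {ε : X → k} {o : X}

/-- The coefficients of stationary paths and arrows can be read off from the diagonal, `src mid` and
`mid snk` entries, because the labels in each family are linearly independent. -/
theorem relationIdeal_le_longPaths [Finite X] (hσ : Function.Injective σ) (ho : σ o = 1)
    (hε : ε o = 0) {f : PathAlgebra k (Layered X)} (hf : f ∈ relationIdeal σ ε) :
    f ∈ longPaths k (Layered X) 2 := by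
  have := Fintype.ofFinite X
  have hf : labelRep k (label σ ε) f = 0 := hf
  refine mem_longPaths_iff.2 fun p hp => ?_
  rcases allPaths_cases p with ⟨x, rfl⟩ | ⟨a, rfl⟩ | ⟨a, rfl⟩ | ⟨a, b, rfl⟩
  · have h := labelRep_apply_same (σ := σ) (ε := ε) f x
    rw [hf, Matrix.zero_apply] at h
    exact absurd ((map_eq_zero_iff _ (FaithfulSMul.algebraMap_injective k _)).1 h.symm) hp
  · have h := labelRep_apply_src_mid (σ := σ) (ε := ε) f
    rw [hf, Matrix.zero_apply] at h
    -- The first family is untwisted.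
    refine absurd (coeff_eq_zero_of_sum_eq_zero (ε := fun _ => (0 : k)) hσ ho rfl
      (fun a => (pathBasis k (Layered X)).repr f ⟨src, mid, (fst a).toPath⟩) ?_ a) hp
    simpa [label] using h.symm
  · have h := labelRep_apply_mid_snk (σ := σ) (ε := ε) f
    rw [hf, Matrix.zero_apply] at h
    exact absurd (coeff_eq_zero_of_sum_eq_zero hσ ho hε _ h.symm a) hp
  · exact le_rfl

theorem longPaths_three : longPaths k (Layered X) 3 = ⊥ := by
  rw [eq_bot_iff, longPaths, Submodule.span_le]
  rintro _ ⟨p, hp, rfl⟩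
  exact absurd (hp.trans (length_le_two p.2.2)) (by decide)

theorem isAdmissible_relationIdeal [Finite X] (hσ : Function.Injective σ) (ho : σ o = 1)
    (hε : ε o = 0) : IsAdmissible (relationIdeal σ ε) where
  isTwoSided := inferInstance
  exists_pow_le := by
    refine ⟨3, by decide, fun f hf => ?_⟩
    have hf := mem_arrowIdeal_pow.1 hf
    rw [longPaths_three, Submodule.mem_bot] at hf
    rw [hf]
    exact zero_mem _
  le_sq _ hf := mem_arrowIdeal_pow.2 (relationIdeal_le_longPaths hσ ho hε hf)

theorem labelRep_nil (x : Layered X) : labelRep k (label σ ε) (ofPath k (Path.nil : Path x x)) =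
    Matrix.single x x 1 := labelRep_ofPath _ _

theorem labelRep_arrow {x y : Layered X} (α : x ⟶ y) :
    labelRep k (label σ ε) (ofPath k α.toPath) = Matrix.single x y (label σ ε α) := by
  rw [labelRep_ofPath, pathLabel_toPath]

theorem label_snd_add (δ : X → k) (ho : σ o = 1) (hε : ε o = 0) (a : X) :
    label σ (ε + δ) (snd a) = label σ ε (snd a) + δ a • label σ ε (snd o) := by
  simp only [label, ho, hε, MonoidAlgebra.single_zero, add_zero, Pi.add_apply,
    MonoidAlgebra.single_add, MonoidAlgebra.smul_single, smul_eq_mul, mul_one, add_assoc]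

/-- The twist is a change of arrows: each `snd a` gains a multiple of `snd o`, which is available in
the range. -/
theorem range_labelRep_add_le (δ : X → k) (ho : σ o = 1) (hε : ε o = 0) :
    (labelRep k (label σ (ε + δ))).range ≤ (labelRep k (label σ ε)).range := by
  refine range_labelRep_le _ _ (fun x => ?_) fun {x y} α => ?_
  · rw [labelRep_nil, ← labelRep_nil (σ := σ) (ε := ε)]
    exact AlgHom.mem_range_self _ _
  · rw [labelRep_arrow]
    have hmem {x y : Layered X} (β : x ⟶ y) :
        Matrix.single x y (label σ ε β) ∈ (labelRep k (label σ ε)).range := by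
      rw [← labelRep_arrow]
      exact AlgHom.mem_range_self _ _
    rcases α with a | a
    · exact hmem (fst a)
    · change Matrix.single mid snk (label σ (ε + δ) (snd a)) ∈ _
      rw [label_snd_add δ ho hε, Matrix.single_add, ← Matrix.smul_single]
      exact add_mem (hmem (snd a)) (Subalgebra.smul_mem _ (hmem (snd o)) _)

theorem range_labelRep_eq (δ : X → k) (ho : σ o = 1) (hε : ε o = 0) (hδ : δ o = 0) :
    (labelRep k (label σ ε)).range = (labelRep k (label σ δ)).range := by
  have key {ε δ : X → k} (hδ : δ o = 0) :
      (labelRep k (label σ ε)).range ≤ (labelRep k (label σ δ)).range := by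
    have := range_labelRep_add_le (ε - δ) ho hδ
    rwa [add_sub_cancel] at this
  exact le_antisymm (key hδ) (key hε)

variable (σ k) in
/-- The algebra generated by the labels `σ`, as a quotient of the path algebra. -/
abbrev LabelAlgebra : Type w :=
  PathAlgebra k (Layered X) ⧸ RingHom.ker (labelRep k (label σ (0 : X → k))).rangeRestrict

/-- The ranges for `ε` and for `0` coincide, so the representation for `ε` also maps onto the same
algebra. Writing that algebra as a quotient of the path algebra, not as the range, keeps it in the
universe of `k`. -/
theorem isPresentation [Finite X] (hσ : Function.Injective σ) (ho : σ o = 1) (hε : ε o = 0) :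
    IsPresentation (LabelAlgebra k σ) (relationIdeal σ ε) where
  isFiniteConnected := isFiniteConnected o
  isAdmissible := isAdmissible_relationIdeal hσ ho hε
  exists_hom := by
    have hrange := range_labelRep_eq (σ := σ) (ε := ε) (0 : X → k) ho hε rfl
    let e := Ideal.quotientKerAlgEquivOfSurjective
      (labelRep k (label σ (0 : X → k))).rangeRestrict_surjective
    let φ := (labelRep k (label σ ε)).codRestrict (labelRep k (label σ (0 : X → k))).range
      fun f => hrange ▸ AlgHom.mem_range_self _ f
    refine ⟨(e.symm : _ →ₐ[k] LabelAlgebra k σ).comp φ, ?_, ?_⟩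
    · refine e.symm.surjective.comp fun y => ?_
      obtain ⟨f, hf⟩ := hrange.ge y.2
      exact ⟨f, Subtype.ext hf⟩
    · ext f
      rw [RingHom.mem_ker, RingHom.mem_ker]
      change e.symm (φ f) = 0 ↔ _
      rw [map_eq_zero_iff _ e.symm.injective]
      exact Subtype.ext_iff

theorem isTriangularAlgebra [Finite X] (hσ : Function.Injective σ) (ho : σ o = 1) :
    IsTriangularAlgebra k (LabelAlgebra k σ) := by
  have h := isPresentation (k := k) (ε := 0) hσ ho rfl
  have : Module.Finite k (PathAlgebra k (Layered X)) :=
    Module.Finite.of_basis (pathBasis k (Layered X))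
  obtain ⟨ν, hν, -⟩ := h.exists_hom
  exact
    { finite := Module.Finite.of_surjective ν.toLinearMap hν
      isBasic := h.isBasic
      isConnected := h.isConnectedAlgebra
      exists_presentation := ⟨Layered X, _, _, _, isAcyclic, h⟩ }

theorem path_injective {a b a' b' : X} (h : path a b = path a' b') : a = a' ∧ b = b' := by
  cases h
  exact ⟨rfl, rfl⟩

/-- The labels of `path s t`, `path u o`, `path s o` are `σ u + ε t • σ s`, `σ u` and `σ s`. This
gives one minimal relation, with two or three terms according to whether `ε t` vanishes. -/
theorem homotopic_path (hσ : Function.Injective σ) (ho : σ o = 1) (hε : ε o = 0) {s t u : X}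
    (ht : t ≠ o) (hu : σ s * σ t = σ u) :
    Homotopic (relationIdeal σ ε) (Walk.ofPath (path s t)) (Walk.ofPath (path u o)) ∧
      (ε t ≠ 0 → Homotopic (relationIdeal σ ε) (Walk.ofPath (path s t))
        (Walk.ofPath (path s o))) := by
  classical
  have hus : σ u ≠ σ s := fun h => ht (hσ (by rw [ho, ← mul_eq_left (a := σ s), hu, h]))
  have hpq : path s t ≠ path u o := fun h => ht (path_injective h).2
  have hpr : path s t ≠ path s o := fun h => ht (path_injective h).2
  have hqr : path u o ≠ path s o := fun h => hus (congrArg σ (path_injective h).1)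
  let ρ : Path (src : Layered X) snk →₀ k := Finsupp.single (path s t) 1 -
    Finsupp.single (path u o) 1 - Finsupp.single (path s o) (ε t)
  have hρ (p : Path (src : Layered X) snk) : ρ p = (if path s t = p then 1 else 0) -
      (if path u o = p then 1 else 0) - if path s o = p then ε t else 0 := by
    simp only [ρ, Finsupp.sub_apply, Finsupp.single_apply]
  have hp : path s t ∈ ρ.support := by simp [hρ, hpq.symm, hpr.symm]
  have hq : path u o ∈ ρ.support := by simp [hρ, hpq, hqr.symm]
  have hr : path s o ∈ ρ.support ↔ ε t ≠ 0 := by simp [hρ, hpr, hqr]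
  -- Only the distinct elements `σ u` and `σ s` occur. The coefficient at `σ u` ties `path s t` to
  -- `path u o`, the one at `σ s` ties it to `path s o` when `ε t ≠ 0`; a nonempty vanishing partial
  -- sum is thus the whole relation.
  have hsum (J : Finset (Path (src : Layered X) snk)) :
      ∑ p ∈ J, ρ p • pathLabel (label σ ε) p =
        MonoidAlgebra.single (σ u)
          ((if path s t ∈ J then 1 else 0) - if path u o ∈ J then 1 else 0) +
        MonoidAlgebra.single (σ s)
          (ε t * ((if path s t ∈ J then 1 else 0) - if path s o ∈ J then 1 else 0)) := by
    simp only [hρ, sub_smul, Finset.sum_sub_distrib, ite_smul, zero_smul, Finset.sum_ite_eq,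
      pathLabel_path, hu, ho, hε, mul_one, MonoidAlgebra.single_zero, add_zero]
    by_cases h₁ : path s t ∈ J <;> by_cases h₂ : path u o ∈ J <;> by_cases h₃ : path s o ∈ J <;>
      simp [h₁, h₂, h₃, MonoidAlgebra.smul_single, MonoidAlgebra.single_neg]
    abel
  have hmin : IsMinimalRelation (relationIdeal σ ε) ρ := by
    refine ⟨(sum_mem_ker_labelRep_iff _ _ _).2 ?_, ?_, fun J hJ ⟨j, hj⟩ hmem => ?_⟩
    · rw [hsum, if_pos hp, if_pos hq, sub_self, MonoidAlgebra.single_zero, zero_add]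
      by_cases h : ε t = 0
      · rw [h, zero_mul, MonoidAlgebra.single_zero]
      · rw [if_pos (hr.2 h), sub_self, mul_zero, MonoidAlgebra.single_zero]
    · rw [← Finset.card_pair hpq]
      exact Finset.card_le_card (Finset.insert_subset hp (Finset.singleton_subset_iff.2 hq))
    · have h0 := (sum_mem_ker_labelRep_iff _ _ _).1 hmem
      rw [hsum] at h0
      have hcoeff (h : H) := DFunLike.congr_fun (congrArg MonoidAlgebra.coeff h0) h
      have hJ₁ : path s t ∈ J ↔ path u o ∈ J := by
        have := hcoeff (σ u)
        by_cases h₁ : path s t ∈ J <;> by_cases h₂ : path u o ∈ J <;>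
          simp [h₁, h₂, hus.symm] at this ⊢
      have hJ₂ (h : ε t ≠ 0) : path s t ∈ J ↔ path s o ∈ J := by
        have := hcoeff (σ s)
        by_cases h₁ : path s t ∈ J <;> by_cases h₂ : path s o ∈ J <;>
          simp [h₁, h₂, hus, h] at this ⊢
      have hcases (p) (h : p ∈ ρ.support) :
          p = path s t ∨ p = path u o ∨ p = path s o ∧ ε t ≠ 0 := by
        by_contra! hne
        refine Finsupp.mem_support_iff.1 h ?_
        rw [hρ, if_neg hne.1.symm, if_neg hne.2.1.symm]
        by_cases hps : path s o = p
        · rw [if_pos hps, hne.2.2 hps.symm]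
          simp
        · rw [if_neg hps]
          simp
      have hpJ : path s t ∈ J := by
        rcases hcases j (hJ.1 hj) with rfl | rfl | ⟨rfl, h⟩
        · exact hj
        · exact hJ₁.2 hj
        · exact (hJ₂ h).2 hj
      refine hJ.2 fun p h => ?_
      rcases hcases p h with rfl | rfl | ⟨rfl, ht⟩
      · exact hpJ
      · exact hJ₁.1 hpJ
      · exact (hJ₂ ht).1 hpJ
  exact ⟨Homotopic.relation hmin hp hq, fun h => Homotopic.relation hmin hp (hr.2 h)⟩

/-! ### The fundamental group of a twisted presentation -/

section FundamentalGroup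

variable (o) in
/-- The walk from `v` through the source along the arrows with index `o`. -/
def connectingWalk (v x : Layered X) : Walk v x := (baseWalk o v).reverse.comp (baseWalk o x)

variable (σ ε o) in
/-- The class of the closed walk at `v` through the arrows of the first family with indices `a`
and `o`. -/
noncomputable def arrowClass (v : Layered X) (a : X) : FundamentalGroup (relationIdeal σ ε) v :=
  walkClass (relationIdeal σ ε) (connectingWalk o v) (Walk.fwd (fst a) Walk.nil)

variable {v : Layered X}

/-- The arrows with index `o` form the spanning tree used by the connecting walks, so they have
trivial class. -/
theorem walkClass_base_arrow {x y : Layered X} (α : x ⟶ y)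
    (h : baseWalk o y = (baseWalk o x).comp (Walk.fwd α Walk.nil)) :
    walkClass (relationIdeal σ ε) (connectingWalk o v) (Walk.fwd α Walk.nil) = 1 := by
  refine Quotient.sound (s := homotopySetoid (relationIdeal σ ε) v) ?_
  change Homotopic _ ((connectingWalk o v x).comp ((Walk.fwd α Walk.nil).comp
    (connectingWalk o v y).reverse)) Walk.nil
  have : (connectingWalk o v x).comp (Walk.fwd α Walk.nil) = connectingWalk o v y := by
    rw [connectingWalk, connectingWalk, h, Walk.comp_assoc]
  rw [← Walk.comp_assoc, this]
  exact Homotopic.comp_reverse _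

theorem arrowClass_base : arrowClass σ ε o v o = 1 := walkClass_base_arrow _ rfl

theorem walkClass_path (a b : X) :
    walkClass (relationIdeal σ ε) (connectingWalk o v) (Walk.ofPath (path a b)) =
      arrowClass σ ε o v a *
        walkClass (relationIdeal σ ε) (connectingWalk o v) (Walk.fwd (snd b) Walk.nil) :=
  walkClass_comp _ _ _

theorem arrowClass_mul_snd (hσ : Function.Injective σ) (ho : σ o = 1) (hε : ε o = 0)
    {s t u : X} (hu : σ s * σ t = σ u) : arrowClass σ ε o v s *
        walkClass (relationIdeal σ ε) (connectingWalk o v) (Walk.fwd (snd t) Walk.nil) =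
      arrowClass σ ε o v u := by
  have hsnd : walkClass (relationIdeal σ ε) (connectingWalk o v) (Walk.fwd (snd o) Walk.nil) = 1 :=
    walkClass_base_arrow _ rfl
  by_cases ht : t = o
  · subst ht
    rw [ho, mul_one] at hu
    rw [hsnd, mul_one, hσ hu]
  · have := walkClass_eq_of_homotopic (connectingWalk o v) (homotopic_path hσ ho hε ht hu).1
    rwa [walkClass_path, walkClass_path, hsnd, mul_one] at this

/-- Taking `s = o` in the product rule shows that both arrows with the same index have the same
class; the product rule then involves the first family only. -/
theorem walkClass_snd (hσ : Function.Injective σ) (ho : σ o = 1) (hε : ε o = 0) (t : X) :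
    walkClass (relationIdeal σ ε) (connectingWalk o v) (Walk.fwd (snd t) Walk.nil) =
      arrowClass σ ε o v t := by
  have := arrowClass_mul_snd (ε := ε) (v := v) hσ ho hε (s := o) (t := t) (u := t)
    (by rw [ho, one_mul])
  rwa [arrowClass_base, one_mul] at this

theorem arrowClass_mul (hσ : Function.Injective σ) (ho : σ o = 1) (hε : ε o = 0)
    {s t u : X} (hu : σ s * σ t = σ u) :
    arrowClass σ ε o v s * arrowClass σ ε o v t = arrowClass σ ε o v u := by
  rw [← walkClass_snd hσ ho hε t, arrowClass_mul_snd hσ ho hε hu]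

/-- With `s = o` the third term of the minimal relation is the base path, whose class is trivial. -/
theorem arrowClass_eq_one (hσ : Function.Injective σ) (ho : σ o = 1) (hε : ε o = 0) {t : X}
    (ht : ε t ≠ 0) : arrowClass σ ε o v t = 1 := by
  have hto : t ≠ o := fun h => ht (h ▸ hε)
  have := walkClass_eq_of_homotopic (connectingWalk o v)
    ((homotopic_path hσ ho hε hto (s := o) (u := t) (by rw [ho, one_mul])).2 ht)
  rwa [walkClass_path, walkClass_path, walkClass_snd hσ ho hε, walkClass_snd hσ ho hε,
    arrowClass_base, one_mul, one_mul] at this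

/-- The degrees of the arrows induced by a group morphism. -/
def arrowDegree {G : Type*} (d : X → G) : ∀ {x y : Layered X}, (x ⟶ y) → G
  | _, _, Hom.fst a => d a
  | _, _, Hom.snd a => d a

/-- If the degrees `π (σ a)` generate `G` and the classes of the arrows are obtained from the
degrees by a group morphism, then `G` is the fundamental group. -/
theorem nonempty_fundamentalGroup_mulEquiv {G : Type*} [Group G] (hσ : Function.Injective σ)
    (ho : σ o = 1) (hε : ε o = 0) (π : H →* G) (hπ : ∀ a, ε a ≠ 0 → π (σ a) = 1)
    (hgen : Subgroup.closure (Set.range fun a => π (σ a)) = ⊤)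
    (F : G →* FundamentalGroup (relationIdeal σ ε) v)
    (hF : ∀ a, F (π (σ a)) = arrowClass σ ε o v a) :
    Nonempty (FundamentalGroup (relationIdeal σ ε) v ≃* G) := by
  classical
  let d {x y : Layered X} (α : x ⟶ y) : G := arrowDegree (fun a => π (σ a)) α
  have hbase (x : Layered X) : Walk.degree d (baseWalk o x) = 1 := by
    cases x <;> simp [baseWalk, Walk.degree, d, arrowDegree, ho]
  have hd {x y : Layered X} (ρ : Path x y →₀ k)
      (hρ : IsMinimalRelation (relationIdeal σ ε) ρ) (p) (hp : p ∈ ρ.support) (q)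
      (hq : q ∈ ρ.support) :
      Walk.degree d (Walk.ofPath p) = Walk.degree d (Walk.ofPath q) := by
    refine degree_eq_of_isMinimalRelation π d (label σ ε) (fun α h hh => ?_) ρ hρ p hp q hq
    rcases α with a | a
    · by_contra hne
      refine hh ?_
      change (MonoidAlgebra.single (σ a) (1 : k)).coeff h = 0
      rw [MonoidAlgebra.coeff_single, Finsupp.single_eq_of_ne]
      rintro rfl
      exact hne rfl
    · by_contra hne
      refine hh ?_
      change (MonoidAlgebra.single (σ a) (1 : k) + MonoidAlgebra.single 1 (ε a)).coeff h = 0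
      have h₁ : h ≠ σ a := by
        rintro rfl
        exact hne rfl
      rw [MonoidAlgebra.coeff_add, Finsupp.add_apply, MonoidAlgebra.coeff_single,
        MonoidAlgebra.coeff_single, Finsupp.single_eq_of_ne h₁, zero_add]
      by_cases h₂ : h = 1
      · subst h₂
        rw [Finsupp.single_eq_same]
        by_contra hεa
        exact hne ((map_one π).trans (hπ a hεa).symm)
      · rw [Finsupp.single_eq_of_ne h₂]
  refine BoundQuiver.nonempty_fundamentalGroup_mulEquiv d (connectingWalk o v) hd
    (Homotopic.reverse_comp _) (fun x => ?_) F (fun {x y} α => ?_) ?_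
  -- The degree of a reversed walk is obtained from homotopy invariance.
  · have hrev := Homotopic.degree_eq d hd (Homotopic.reverse_comp (baseWalk o v))
    rw [Walk.degree_comp, hbase, mul_one] at hrev
    rw [connectingWalk, Walk.degree_comp, hbase, mul_one, hrev]
    rfl
  · rcases α with a | a
    · exact (hF a).symm
    · exact (walkClass_snd hσ ho hε a).trans (hF a).symm
  · rw [eq_top_iff, ← hgen]
    refine Subgroup.closure_mono ?_
    rintro _ ⟨a, rfl⟩
    exact ⟨src, mid, fst a, rfl⟩

end FundamentalGroup

end Layered

end BoundQuiver

/-! ### Assembling the factors -/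

theorem theorem1 {k : Type w} [Field k] {n : ℕ} (G : Fin n → Type u)
    [∀ i, Group (G i)] [∀ i, Group.IsFinitelyPresented (G i)] :
    ∃ (A : Type w) (_ : Ring A) (_ : Algebra k A)
      (V : Type) (_ : Quiver.{0} V) (_ : Fintype V)
      (I : Fin n → Ideal (BoundQuiver.PathAlgebra k V)),
      BoundQuiver.IsTriangularAlgebra k A ∧
      BoundQuiver.IsAcyclic V ∧
      ∀ i, BoundQuiver.IsPresentation A (I i) ∧
        ∀ v : V, Nonempty (BoundQuiver.FundamentalGroup (I i) v ≃* G i) := by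
  classical
  choose S hSgen hSext using fun i =>
    Group.IsFinitelyPresented.exists_finset_extension.{u, 0} (G i)
  -- `Pi.mulSingle i` embeds the `i`-th factor, so products inside `S i` remain products inside `T`.
  let T : Finset (∀ i, G i) :=
    insert 1 (Finset.univ.biUnion fun i => (S i).image (Pi.mulSingle i))
  have hT_single (i) (s : G i) (hs : s ∈ S i) : Pi.mulSingle i s ∈ T :=
    Finset.mem_insert_of_mem (Finset.mem_biUnion.2 ⟨i, Finset.mem_univ i,
      Finset.mem_image_of_mem _ hs⟩)
  let X := Fin T.card
  let σ : X → ∀ i, G i := fun a => T.equivFin.symm a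
  have hσ : Function.Injective σ := Subtype.val_injective.comp T.equivFin.symm.injective
  have hσT (g) (hg : g ∈ T) : ∃ a, σ a = g := ⟨T.equivFin ⟨g, hg⟩, by simp [σ]⟩
  obtain ⟨o, ho⟩ := hσT 1 (Finset.mem_insert_self _ _)
  -- The twist kills every element with trivial `i`-th coordinate; `o` is excluded because `ε o = 0`
  -- is needed, and its class is trivial anyway.
  let ε : Fin n → X → k := fun i a => if σ a i = 1 ∧ a ≠ o then 1 else 0
  have hε (i) : ε i o = 0 := by simp [ε]
  refine ⟨BoundQuiver.Layered.LabelAlgebra k σ, inferInstance, inferInstance,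
    BoundQuiver.Layered X, inferInstance, inferInstance,
    fun i => BoundQuiver.Layered.relationIdeal σ (ε i),
    BoundQuiver.Layered.isTriangularAlgebra hσ ho, BoundQuiver.Layered.isAcyclic,
    fun i => ⟨BoundQuiver.Layered.isPresentation hσ ho (hε i), fun v => ?_⟩⟩
  choose a ha using fun (s : S i) => hσT _ (hT_single i s s.2)
  -- The value `1` outside `S i` is arbitrary: the extension property looks at `f` on `S i` only.
  let f : G i → BoundQuiver.FundamentalGroup (BoundQuiver.Layered.relationIdeal σ (ε i)) v :=
    fun g => if hg : g ∈ S i then BoundQuiver.Layered.arrowClass σ (ε i) o v (a ⟨g, hg⟩) else 1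
  obtain ⟨F, hF⟩ := hSext i _ f fun s hs t ht hst => by
    simp only [f, dif_pos hs, dif_pos ht, dif_pos hst]
    rw [BoundQuiver.Layered.arrowClass_mul hσ ho (hε i)]
    rw [ha, ha, ha, ← Pi.mulSingle_mul]
  refine BoundQuiver.Layered.nonempty_fundamentalGroup_mulEquiv hσ ho (hε i)
    (Pi.evalMonoidHom G i) (fun b hb => ?_) ?_ F fun b => ?_
  · by_contra hne
    exact hb (if_neg fun h => hne h.1)
  · rw [eq_top_iff, ← hSgen i]
    refine Subgroup.closure_mono fun s hs => ⟨a ⟨s, hs⟩, ?_⟩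
    exact (congrFun (ha ⟨s, hs⟩) i).trans (Pi.mulSingle_eq_same i s)
  · have h_one (h : σ b i = 1) :
        F (σ b i) = BoundQuiver.Layered.arrowClass σ (ε i) o v b := by
      rw [h, map_one]
      by_cases hb : b = o
      · rw [hb, BoundQuiver.Layered.arrowClass_base]
      · rw [BoundQuiver.Layered.arrowClass_eq_one hσ ho (hε i)]
        rw [show ε i b = 1 from if_pos ⟨h, hb⟩]
        exact one_ne_zero
    change F (σ b i) = _
    -- An element of `T` is `1`, comes from the factor `i`, where `F` extends `f`, or comes from
    -- another factor and has trivial `i`-th coordinate.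
    rcases Finset.mem_insert.1 (T.equivFin.symm b).2 with hb | hb
    · exact h_one (congrFun hb i)
    · obtain ⟨j, -, hj⟩ := Finset.mem_biUnion.1 hb
      obtain ⟨s, hs, hsb⟩ := Finset.mem_image.1 hj
      have hsb : σ b = Pi.mulSingle j s := hsb.symm
      by_cases hij : i = j
      · subst hij
        obtain rfl : a ⟨s, hs⟩ = b := hσ ((ha _).trans hsb.symm)
        rw [ha, Pi.mulSingle_eq_same, hF s hs]
        exact dif_pos hs
      · exact h_one (by rw [hsb, Pi.mulSingle_eq_of_ne hij])
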